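/- Let $R$ be a commutative local ring whose maximal ideal $\mathfrak m$ satisfies $\mathfrak m=(2)\neq 0$ and $\mathfrak m^2=0$ (for example $R=\mathbb Z/4$), and let $\mathcal F(R)$ be the category of finitely generated free $R$-modules. Then $\mathcal F(R)$ has a unique structure of a triangulated category with identity translation functor $\Sigma=\mathrm{Id}$ such that $$R\xrightarrow{\;2\;}R\xrightarrow{\;2\;}R\xrightarrow{\;2\;}R$$ is an exact triangle. Moreover, a diagram $A\to B\to C\to A$ in $\mathcal F(R)$ is an exact triangle of this structure if and only if it is isomorphic, as a triangle, to the direct sum of a contractible triangle and a triangle $X\xrightarrow{2}X\xrightarrow{2}X\xrightarrow{2}X$ for some $X$ in $\mathcal F(R)$. Here a triangle $A\xrightarrow{f}B\xrightarrow{i}C\xrightarrow{q}\Sigma A$ is called contractible if $if=0$, $qi=0$, $(\Sigma f)q=0$ and there are morphisms $\Theta\colon B\to A$, $\Phi\colon C\to B$, $\Psi\colon \Sigma A\to C$ with $1_B=\Phi i+f\Theta$, $1_C=\Psi q+i\Phi$ and $1_{\Sigma A}=\Sigma(\Theta f)+q\Psi$. -/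

import Mathlib

open CategoryTheory Category Limits Pretriangulated

universe v u

noncomputable section

namespace FreeTriangulation

section General

variable {C : Type u} [Category.{v} C] [HasShift C ℤ] [Preadditive C]

/-- A candidate triangle: a diagram `A ⟶ B ⟶ C ⟶ ΣA` in which consecutive composites
(including `C ⟶ ΣA ⟶ ΣB`) vanish. -/
structure IsCandidate (T : Triangle C) : Prop where
  zero₁₂ : T.mor₁ ≫ T.mor₂ = 0
  zero₂₃ : T.mor₂ ≫ T.mor₃ = 0
  zero₃₁ : T.mor₃ ≫ T.mor₁⟦(1 : ℤ)⟧' = 0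

/-- A contractible triangle: a candidate triangle admitting a homotopy `(Θ, Φ, Ψ)` from the zero
morphism to the identity. -/
def IsContractible (T : Triangle C) : Prop :=
  IsCandidate T ∧
    ∃ (Θ : T.obj₂ ⟶ T.obj₁) (Φ : T.obj₃ ⟶ T.obj₂) (Ψ : T.obj₁⟦(1 : ℤ)⟧ ⟶ T.obj₃),
      𝟙 T.obj₂ = T.mor₂ ≫ Φ + Θ ≫ T.mor₁ ∧
      𝟙 T.obj₃ = T.mor₃ ≫ Ψ + Φ ≫ T.mor₂ ∧
      (𝟙 T.obj₁)⟦(1 : ℤ)⟧' = (T.mor₁ ≫ Θ)⟦(1 : ℤ)⟧' + Ψ ≫ T.mor₃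

/-- The direct sum of two triangles. -/
def directSum [HasBinaryBiproducts C] (T₁ T₂ : Triangle C) : Triangle C :=
  Triangle.mk (biprod.map T₁.mor₁ T₂.mor₁) (biprod.map T₁.mor₂ T₂.mor₂)
    (biprod.desc (T₁.mor₃ ≫ (biprod.inl : T₁.obj₁ ⟶ T₁.obj₁ ⊞ T₂.obj₁)⟦(1 : ℤ)⟧')
      (T₂.mor₃ ≫ (biprod.inr : T₂.obj₁ ⟶ T₁.obj₁ ⊞ T₂.obj₁)⟦(1 : ℤ)⟧'))

end General

variable (R : Type u) [CommRing R]

/-- The property of being a finitely generated free `R`-module. -/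
def isFiniteFree : ObjectProperty (ModuleCat.{u} R) :=
  fun M => Module.Finite R M ∧ Module.Free R M

/-- The category of finitely generated free `R`-modules. -/
abbrev FiniteFree : Type (u + 1) := (isFiniteFree R).FullSubcategory

/-- The module `R` as an object of the category of finitely generated free `R`-modules. -/
def FiniteFree.unit : FiniteFree R := ⟨ModuleCat.of R R, inferInstance, inferInstance⟩

instance : HasZeroObject (FiniteFree R) where
  zero := by
    refine ⟨⟨ModuleCat.of R PUnit, inferInstance, inferInstance⟩, ?_⟩
    rw [IsZero.iff_id_eq_zero]
    apply ObjectProperty.hom_ext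
    exact (ModuleCat.isZero_of_subsingleton (ModuleCat.of R PUnit)).eq_of_src _ _

instance : HasBinaryBiproducts (FiniteFree R) where
  has_binary_biproduct X Y := by
    have := X.property.1
    have := X.property.2
    have := Y.property.1
    have := Y.property.2
    let P : FiniteFree R := ⟨ModuleCat.of R (X.obj × Y.obj),
      inferInstanceAs (Module.Finite R (X.obj × Y.obj)),
      inferInstanceAs (Module.Free R (X.obj × Y.obj))⟩
    let b : BinaryBicone X Y :=
      { pt := P
        fst := ObjectProperty.homMk (ModuleCat.ofHom (LinearMap.fst R X.obj Y.obj))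
        snd := ObjectProperty.homMk (ModuleCat.ofHom (LinearMap.snd R X.obj Y.obj))
        inl := ObjectProperty.homMk (ModuleCat.ofHom (LinearMap.inl R X.obj Y.obj))
        inr := ObjectProperty.homMk (ModuleCat.ofHom (LinearMap.inr R X.obj Y.obj))
        inl_fst := by
          apply ObjectProperty.hom_ext; ext x; rfl
        inl_snd := by
          apply ObjectProperty.hom_ext; ext x; rfl
        inr_fst := by
          apply ObjectProperty.hom_ext; ext x; rfl
        inr_snd := by
          apply ObjectProperty.hom_ext; ext x; rfl }
    refine HasBinaryBiproduct.mk ⟨b, isBinaryBilimitOfTotal b ?_⟩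
    apply ObjectProperty.hom_ext
    apply ModuleCat.hom_ext
    apply LinearMap.ext
    rintro ⟨x, y⟩
    change ((x, 0) : X.obj × Y.obj) + (0, y) = (x, y)
    simp

/-- The identity translation functor: every integer acts by the identity functor. -/
instance : HasShift (FiniteFree R) ℤ :=
  hasShiftMk (FiniteFree R) ℤ
    { F := fun _ => 𝟭 (FiniteFree R)
      zero := Iso.refl _
      add := fun _ _ => (Functor.leftUnitor _).symm }

theorem shiftFunctor_eq_id (n : ℤ) : shiftFunctor (FiniteFree R) n = 𝟭 (FiniteFree R) := rfl

instance (n : ℤ) : (shiftFunctor (FiniteFree R) n).Additive :=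
  inferInstanceAs (𝟭 (FiniteFree R)).Additive

variable {R}

/-- The triangle `X ⟶ X ⟶ X ⟶ X` all of whose morphisms are multiplication by `2`
(recall that `ΣX = X`). -/
def twoTriangle (X : FiniteFree R) : Triangle (FiniteFree R) :=
  Triangle.mk (2 • 𝟙 X : X ⟶ X) (2 • 𝟙 X : X ⟶ X) (2 • 𝟙 X : X ⟶ X)

end FreeTriangulation

end

/-! Since translation is the identity, a triangle is a three-periodic complex. The class of exact
triangles is described intrinsically by `IsExact`: every contravariant representable functor is
exact on the complex, and every square into `two W` extends to a morphism (`fill`). Both conditions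
are forced in any triangulation containing the triangle of `2` on `R`: the first by the long exact
sequences, the second by completion of morphisms, applied coordinatewise on a free `W`.

The converse rests on a normal form. A matrix over `R` has a generalized inverse over the residue
field; because `4 = 0`, this lifts to show that every morphism is isomorphic to a split morphism
plus `2 • 𝟙 X` (`IsTwoRegular.exists_iso_map_two`). A split morphism completes to a contractible
complex, so every morphism starts an exact complex. Squares out of an exact complex extend into
contractible complexes by exactness and into `two X` by `fill`. With the five lemma, an exact
complex is therefore determined by its first map, which gives the decomposition and uniqueness.

For the octahedral axiom, a square between exact complexes is extended so that the mapping cone is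
exact (`CyclicComplex.IsExact.exists_hom_cone`). Up to homotopy the problem lives on maps `two X ⟶
two Y`, where the common component can be taken with an exact generalized inverse. The octahedron is
then a direct summand of two successive cones. -/

namespace FreeTriangulation

/-- A preadditive category in which `4 = 0`, every morphism killed by `2` is divisible by `2`, and
every morphism has a generalized inverse modulo `2`. -/
class IsTwoRegular (𝒞 : Type u) [Category.{v} 𝒞] [Preadditive 𝒞] : Prop where
  four_smul : ∀ {X Y : 𝒞} (x : X ⟶ Y), 2 • 2 • x = 0
  exists_eq_two_smul : ∀ {X Y : 𝒞} (x : X ⟶ Y), 2 • x = 0 → ∃ y, x = 2 • y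
  exists_inverse_mod_two : ∀ {X Y : 𝒞} (x : X ⟶ Y),
    ∃ (y : Y ⟶ X) (z : X ⟶ Y), x ≫ y ≫ x + 2 • z = x

/-- A three-periodic complex. -/
structure CyclicComplex {𝒞 : Type u} [Category.{v} 𝒞] [Preadditive 𝒞] (A B C : 𝒞) where
  f : A ⟶ B
  i : B ⟶ C
  q : C ⟶ A
  f_i : f ≫ i = 0 := by cat_disch
  i_q : i ≫ q = 0 := by cat_disch
  q_f : q ≫ f = 0 := by cat_disch

/-! ### Three-periodic complexes and exactness -/

namespace CyclicComplex

attribute [simp] f_i i_q q_f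

variable {𝒞 : Type u} [Category.{v} 𝒞] [Preadditive 𝒞] {A B C A' B' C' : 𝒞}

@[simp] theorem f_i_assoc (T : CyclicComplex A B C) {W : 𝒞} (x : C ⟶ W) :
    T.f ≫ T.i ≫ x = 0 := by
  rw [← assoc, T.f_i, zero_comp]

@[simp] theorem i_q_assoc (T : CyclicComplex A B C) {W : 𝒞} (x : A ⟶ W) :
    T.i ≫ T.q ≫ x = 0 := by
  rw [← assoc, T.i_q, zero_comp]

@[simp] theorem q_f_assoc (T : CyclicComplex A B C) {W : 𝒞} (x : B ⟶ W) :
    T.q ≫ T.f ≫ x = 0 := by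
  rw [← assoc, T.q_f, zero_comp]

/-- A morphism of three-periodic complexes. -/
structure Hom (S : CyclicComplex A B C) (T : CyclicComplex A' B' C') where
  a : A ⟶ A'
  b : B ⟶ B'
  c : C ⟶ C'
  f_b : S.f ≫ b = a ≫ T.f := by cat_disch
  i_c : S.i ≫ c = b ≫ T.i := by cat_disch
  q_a : S.q ≫ a = c ≫ T.q := by cat_disch

theorem Hom.f_b_assoc {S : CyclicComplex A B C} {T : CyclicComplex A' B' C'} (φ : Hom S T) {W : 𝒞}
    (x : B' ⟶ W) : S.f ≫ φ.b ≫ x = φ.a ≫ T.f ≫ x := by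
  rw [← assoc, φ.f_b, assoc]

theorem Hom.i_c_assoc {S : CyclicComplex A B C} {T : CyclicComplex A' B' C'} (φ : Hom S T) {W : 𝒞}
    (x : C' ⟶ W) : S.i ≫ φ.c ≫ x = φ.b ≫ T.i ≫ x := by
  rw [← assoc, φ.i_c, assoc]

theorem Hom.q_a_assoc {S : CyclicComplex A B C} {T : CyclicComplex A' B' C'} (φ : Hom S T) {W : 𝒞}
    (x : A' ⟶ W) : S.q ≫ φ.a ≫ x = φ.c ≫ T.q ≫ x := by
  rw [← assoc, φ.q_a, assoc]

/-- The complex `X ⟶ X ⟶ X ⟶ X` all of whose differentials are multiplication by `2`. -/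
@[simps]
def two [IsTwoRegular 𝒞] (X : 𝒞) : CyclicComplex X X X where
  f := 2 • 𝟙 X
  i := 2 • 𝟙 X
  q := 2 • 𝟙 X
  f_i := by simpa using IsTwoRegular.four_smul (𝟙 X)
  i_q := by simpa using IsTwoRegular.four_smul (𝟙 X)
  q_f := by simpa using IsTwoRegular.four_smul (𝟙 X)

/-- The exactness condition characterizing the distinguished triangles: contravariant
representable functors are exact on the complex, and squares into the complexes `two W` extend to
morphisms of complexes. -/
structure IsExact (T : CyclicComplex A B C) : Prop where
  exact_A : ∀ {W : 𝒞} (x : A ⟶ W), T.q ≫ x = 0 → ∃ y, x = T.f ≫ y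
  exact_B : ∀ {W : 𝒞} (x : B ⟶ W), T.f ≫ x = 0 → ∃ y, x = T.i ≫ y
  exact_C : ∀ {W : 𝒞} (x : C ⟶ W), T.i ≫ x = 0 → ∃ y, x = T.q ≫ y
  fill : ∀ {W : 𝒞} (a : A ⟶ W) (b : B ⟶ W), T.f ≫ b = 2 • a →
    ∃ c, T.i ≫ c = 2 • b ∧ T.q ≫ a = 2 • c

/-- A three-periodic complex with a contracting homotopy. -/
def IsNullhomotopic (T : CyclicComplex A B C) : Prop :=
  ∃ (h₁ : B ⟶ A) (h₂ : C ⟶ B) (h₃ : A ⟶ C),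
    T.f ≫ h₁ + h₃ ≫ T.q = 𝟙 A ∧ T.i ≫ h₂ + h₁ ≫ T.f = 𝟙 B ∧ T.q ≫ h₃ + h₂ ≫ T.i = 𝟙 C

/-- The rotation of a three-periodic complex. -/
@[simps]
def rotate (T : CyclicComplex A B C) : CyclicComplex B C A where
  f := T.i
  i := T.q
  q := -T.f

section

variable [IsTwoRegular 𝒞]

/-- One closure property for two uses: with zero homotopies it covers direct summands, with zero
morphisms it covers contractible complexes. -/
theorem IsExact.of_homotopyRetract {S : CyclicComplex A B C} {T : CyclicComplex A' B' C'}
    (hT : T.IsExact)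
    (s : Hom S T) (r : Hom T S) (h₁ : B ⟶ A) (h₂ : C ⟶ B) (h₃ : A ⟶ C)
    (hA : s.a ≫ r.a + (S.f ≫ h₁ + h₃ ≫ S.q) = 𝟙 A)
    (hB : s.b ≫ r.b + (S.i ≫ h₂ + h₁ ≫ S.f) = 𝟙 B)
    (hC : s.c ≫ r.c + (S.q ≫ h₃ + h₂ ≫ S.i) = 𝟙 C) : S.IsExact where
  exact_A {W} x hx := by
    obtain ⟨y, hy⟩ := hT.exact_A (r.a ≫ x) (by rw [r.q_a_assoc, hx, comp_zero])
    refine ⟨s.b ≫ y + h₁ ≫ x, ?_⟩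
    calc x = (s.a ≫ r.a + (S.f ≫ h₁ + h₃ ≫ S.q)) ≫ x := by rw [hA, id_comp]
      _ = _ := by simp [hx, hy, s.f_b_assoc]
  exact_B {W} x hx := by
    obtain ⟨y, hy⟩ := hT.exact_B (r.b ≫ x) (by rw [r.f_b_assoc, hx, comp_zero])
    refine ⟨s.c ≫ y + h₂ ≫ x, ?_⟩
    calc x = (s.b ≫ r.b + (S.i ≫ h₂ + h₁ ≫ S.f)) ≫ x := by rw [hB, id_comp]
      _ = _ := by simp [hx, hy, s.i_c_assoc]
  exact_C {W} x hx := by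
    obtain ⟨y, hy⟩ := hT.exact_C (r.c ≫ x) (by rw [r.i_c_assoc, hx, comp_zero])
    refine ⟨s.a ≫ y + h₃ ≫ x, ?_⟩
    calc x = (s.c ≫ r.c + (S.q ≫ h₃ + h₂ ≫ S.i)) ≫ x := by rw [hC, id_comp]
      _ = _ := by simp [hx, hy, s.q_a_assoc]
  fill {W} a b hab := by
    obtain ⟨c, hc, hc'⟩ := hT.fill (r.a ≫ a) (r.b ≫ b) (by rw [r.f_b_assoc, hab, Preadditive.comp_nsmul])
    have hqa : 2 • S.q ≫ a = 0 := by rw [← Preadditive.comp_nsmul, ← hab, q_f_assoc]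
    obtain ⟨w, hw⟩ := IsTwoRegular.exists_eq_two_smul _ hqa
    have eA := congr($hA ≫ a)
    have eB := congr($hB ≫ b)
    have e1 := congr(s.b ≫ $hc)
    have e2 := congr(s.c ≫ $hc')
    have e3 := congr(S.q ≫ $eA)
    simp only [Preadditive.add_comp, Preadditive.comp_add, assoc, id_comp, Preadditive.comp_nsmul, hab, hw,
      q_f_assoc, s.q_a_assoc] at eA eB e1 e2 e3
    rw [← s.i_c_assoc] at e1
    have four := fun {X Y : 𝒞} (x : X ⟶ Y) ↦ IsTwoRegular.four_smul x
    -- The last two terms absorb the homotopy in the two equations separately: the first vanishes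
    -- after doubling, the second after composing with `S.i`.
    refine ⟨s.c ≫ c + 2 • h₂ ≫ b + S.q ≫ h₃ ≫ w, ?_, ?_⟩
    · simp only [Preadditive.comp_add, Preadditive.comp_nsmul, i_q_assoc, e1]
      linear_combination (norm := module) (2 : ℤ) • eB - four (h₁ ≫ a)
    · simp only [nsmul_add]
      linear_combination (norm := module) e2 - e3 - four (h₂ ≫ b) + hw

end
end CyclicComplex
end FreeTriangulation

/-! ### Stability of exactness and extension of squares -/

namespace FreeTriangulation
namespace CyclicComplex

variable {𝒞 : Type u} [Category.{v} 𝒞] [Preadditive 𝒞] {A B C A' B' C' : 𝒞}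

theorem IsExact.of_retract [IsTwoRegular 𝒞] {S : CyclicComplex A B C} {T : CyclicComplex A' B' C'}
    (hT : T.IsExact)
    (s : Hom S T) (r : Hom T S) (hA : s.a ≫ r.a = 𝟙 A) (hB : s.b ≫ r.b = 𝟙 B)
    (hC : s.c ≫ r.c = 𝟙 C) : S.IsExact :=
  hT.of_homotopyRetract s r 0 0 0 (by simpa) (by simpa) (by simpa)

/-- The zero morphism. -/
instance (S : CyclicComplex A B C) (T : CyclicComplex A' B' C') : Zero (Hom S T) where
  zero := ⟨0, 0, 0, by simp only [comp_zero, zero_comp], by simp only [comp_zero, zero_comp],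
    by simp only [comp_zero, zero_comp]⟩

theorem Hom.zero_a (S : CyclicComplex A B C) (T : CyclicComplex A' B' C') :
    (0 : Hom S T).a = 0 := rfl

theorem Hom.zero_b (S : CyclicComplex A B C) (T : CyclicComplex A' B' C') :
    (0 : Hom S T).b = 0 := rfl

theorem Hom.zero_c (S : CyclicComplex A B C) (T : CyclicComplex A' B' C') :
    (0 : Hom S T).c = 0 := rfl

theorem isExact_two [IsTwoRegular 𝒞] (X : 𝒞) : (two X).IsExact where
  exact_A x hx := by
    simpa using IsTwoRegular.exists_eq_two_smul x (by simpa using hx)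
  exact_B x hx := by
    simpa using IsTwoRegular.exists_eq_two_smul x (by simpa using hx)
  exact_C x hx := by
    simpa using IsTwoRegular.exists_eq_two_smul x (by simpa using hx)
  fill a b hab := by
    exact ⟨a, by simpa using hab.symm, by simp⟩

theorem IsNullhomotopic.isExact [IsTwoRegular 𝒞] {T : CyclicComplex A B C} (h : T.IsNullhomotopic) :
    T.IsExact := by
  obtain ⟨h₁, h₂, h₃, hA, hB, hC⟩ := h
  -- A contractible complex is a homotopy retract of any complex through zero maps; `two A` is just
  -- an available exact one.
  exact (isExact_two A).of_homotopyRetract 0 0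
    h₁ h₂ h₃ (by simpa [Hom.zero_a]) (by simpa [Hom.zero_b]) (by simpa [Hom.zero_c])

/-- Only `fill` is not visibly cyclic. The missing component is found by dividing by `2`; filling
again from there returns to a given component up to a morphism that exactness controls, and the
resulting error is corrected by a multiple of `2`. Signs are harmless since `4 = 0`. -/
theorem isExact_rotate_iff [IsTwoRegular 𝒞] {T : CyclicComplex A B C} :
    T.rotate.IsExact ↔ T.IsExact := by
  have four := fun {X Y : 𝒞} (x : X ⟶ Y) ↦ IsTwoRegular.four_smul x
  refine ⟨fun h ↦ ⟨?_, fun x hx ↦ h.exact_A x (by simpa using hx),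
    fun x ↦ h.exact_B x, ?_⟩, fun h ↦ ⟨fun x hx ↦ h.exact_B x (by simpa using hx),
    fun x ↦ h.exact_C x, ?_, ?_⟩⟩
  · intro W x hx
    obtain ⟨y, hy⟩ := h.exact_C x hx
    exact ⟨-y, by simpa using hy⟩
  · intro W a b hab
    obtain ⟨c₀, hc₀⟩ := IsTwoRegular.exists_eq_two_smul (T.q ≫ a) (by
      rw [← Preadditive.comp_nsmul, ← hab, q_f_assoc])
    obtain ⟨b₀, hb₀⟩ := IsTwoRegular.exists_eq_two_smul (T.i ≫ c₀) (by
      rw [← Preadditive.comp_nsmul, ← hc₀, i_q_assoc])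
    obtain ⟨a₀, ha₀, ha₀'⟩ := h.fill b₀ c₀ hb₀
    obtain ⟨t, ht⟩ := h.exact_C (a - a₀) (by
      change T.q ≫ (a - a₀) = 0
      change T.q ≫ a₀ = _ at ha₀
      rw [Preadditive.comp_sub, ha₀, hc₀, sub_self])
    replace ha₀' : (-T.f) ≫ b₀ = 2 • a₀ := ha₀'
    replace ht : a - a₀ = (-T.f) ≫ t := ht
    obtain ⟨s, hs⟩ := h.exact_A (b - b₀ + 2 • t) (by
      change (-T.f) ≫ (b - b₀ + 2 • t) = 0
      simp only [Preadditive.neg_comp, Preadditive.comp_add, Preadditive.comp_sub,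
        Preadditive.comp_nsmul] at *
      linear_combination (norm := module) -hab - (2 : ℤ) • ht - ha₀' - four a₀)
    replace hs : b - b₀ + 2 • t = T.i ≫ s := hs
    refine ⟨c₀ + 2 • s, ?_, ?_⟩
    · simp only [Preadditive.comp_add, Preadditive.comp_nsmul, hb₀]
      linear_combination (norm := module) (-2 : ℤ) • hs + four t
    · linear_combination (norm := module) hc₀ - four s
  · intro W x hx
    obtain ⟨y, hy⟩ := h.exact_A x hx
    exact ⟨-y, by simpa using hy⟩
  · intro W b c hbc
    change T.i ≫ c = 2 • b at hbc
    change ∃ a, T.q ≫ a = 2 • c ∧ (-T.f) ≫ b = 2 • a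
    obtain ⟨a, ha⟩ := IsTwoRegular.exists_eq_two_smul (T.f ≫ b) (by
      rw [← Preadditive.comp_nsmul, ← hbc, f_i_assoc])
    obtain ⟨c', hc', hc''⟩ := h.fill a b ha
    obtain ⟨t, ht⟩ := h.exact_C (c - c') (by rw [Preadditive.comp_sub, hbc, hc', sub_self])
    refine ⟨a + 2 • t, ?_, ?_⟩
    · rw [Preadditive.comp_add, Preadditive.comp_nsmul]
      linear_combination (norm := module) hc'' - (2 : ℤ) • ht
    · rw [Preadditive.neg_comp]
      linear_combination (norm := module) - ha - four t - four a

/-- A commutative square from an exact complex to a contractible one extends. -/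
theorem IsExact.exists_hom_nullhomotopic {S : CyclicComplex A B C} {K : CyclicComplex A' B' C'}
    (hS : S.IsExact)
    (hK : K.IsNullhomotopic) (a : A ⟶ A') (b : B ⟶ B') (hab : S.f ≫ b = a ≫ K.f) :
    ∃ c, S.i ≫ c = b ≫ K.i ∧ S.q ≫ a = c ≫ K.q := by
  obtain ⟨h₁, h₂, h₃, hA, hB, hC⟩ := hK
  obtain ⟨s, hs⟩ := hS.exact_B (b ≫ K.i ≫ h₂) (by rw [reassoc_of% hab, f_i_assoc, comp_zero])
  have eB := congr(b ≫ $hB ≫ K.i)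
  have eA := congr(S.q ≫ a ≫ $hA)
  simp only [Preadditive.add_comp, Preadditive.comp_add, assoc, id_comp, comp_id, f_i,
    comp_zero, add_zero] at eA eB
  rw [← reassoc_of% hab, q_f_assoc, zero_add] at eA
  refine ⟨s ≫ K.i + S.q ≫ a ≫ h₃, ?_, ?_⟩
  · rw [Preadditive.comp_add, ← reassoc_of% hs, i_q_assoc, add_zero, eB]
  · simp [eA]

/-- The direct sum of two three-periodic complexes. -/
@[simps]
noncomputable def sum [HasBinaryBiproducts 𝒞] (S : CyclicComplex A B C) (T : CyclicComplex A' B' C') :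
    CyclicComplex (A ⊞ A') (B ⊞ B') (C ⊞ C') where
  f := biprod.map S.f T.f
  i := biprod.map S.i T.i
  q := biprod.map S.q T.q

theorem IsExact.exists_hom_sum_two [IsTwoRegular 𝒞] [HasBinaryBiproducts 𝒞]
    {S : CyclicComplex A B C} {K : CyclicComplex A' B' C'} {X : 𝒞} (hS : S.IsExact)
    (hK : K.IsNullhomotopic) (a : A ⟶ A' ⊞ X) (b : B ⟶ B' ⊞ X)
    (hab : S.f ≫ b = a ≫ (K.sum (two X)).f) :
    ∃ φ : Hom S (K.sum (two X)), φ.a = a ∧ φ.b = b := by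
  obtain ⟨c₁, h₁, h₁'⟩ := hS.exists_hom_nullhomotopic hK (a ≫ biprod.fst) (b ≫ biprod.fst)
    (by simpa using congr($hab ≫ biprod.fst))
  obtain ⟨c₂, h₂, h₂'⟩ := hS.fill (a ≫ biprod.snd) (b ≫ biprod.snd)
    (by simpa using congr($hab ≫ biprod.snd))
  refine ⟨⟨a, b, biprod.lift c₁ c₂, hab, ?_, ?_⟩, rfl, rfl⟩
  · apply biprod.hom_ext <;> simp [h₁, h₂]
  · apply biprod.hom_ext <;> simp [h₁', h₂']

theorem IsExact.sum [IsTwoRegular 𝒞] [HasBinaryBiproducts 𝒞]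
    {S : CyclicComplex A B C} {T : CyclicComplex A' B' C'} (hS : S.IsExact)
    (hT : T.IsExact) : (S.sum T).IsExact where
  exact_A x hx := by
    obtain ⟨y, hy⟩ := hS.exact_A (biprod.inl ≫ x) (by simpa using congr(biprod.inl ≫ $hx))
    obtain ⟨z, hz⟩ := hT.exact_A (biprod.inr ≫ x) (by simpa using congr(biprod.inr ≫ $hx))
    exact ⟨biprod.desc y z, by apply biprod.hom_ext' <;> simp [hy, hz]⟩
  exact_B x hx := by
    obtain ⟨y, hy⟩ := hS.exact_B (biprod.inl ≫ x) (by simpa using congr(biprod.inl ≫ $hx))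
    obtain ⟨z, hz⟩ := hT.exact_B (biprod.inr ≫ x) (by simpa using congr(biprod.inr ≫ $hx))
    exact ⟨biprod.desc y z, by apply biprod.hom_ext' <;> simp [hy, hz]⟩
  exact_C x hx := by
    obtain ⟨y, hy⟩ := hS.exact_C (biprod.inl ≫ x) (by simpa using congr(biprod.inl ≫ $hx))
    obtain ⟨z, hz⟩ := hT.exact_C (biprod.inr ≫ x) (by simpa using congr(biprod.inr ≫ $hx))
    exact ⟨biprod.desc y z, by apply biprod.hom_ext' <;> simp [hy, hz]⟩
  fill a b hab := by
    obtain ⟨y, hy, hy'⟩ := hS.fill (biprod.inl ≫ a) (biprod.inl ≫ b)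
      (by simpa using congr(biprod.inl ≫ $hab))
    obtain ⟨z, hz, hz'⟩ := hT.fill (biprod.inr ≫ a) (biprod.inr ≫ b)
      (by simpa using congr(biprod.inr ≫ $hab))
    exact ⟨biprod.desc y z, by apply biprod.hom_ext' <;> simp [hy, hz],
      by apply biprod.hom_ext' <;> simp [hy', hz']⟩

/-- The five lemma for exact three-periodic complexes. -/
theorem Hom.isIso_c {S : CyclicComplex A B C} {T : CyclicComplex A' B' C'} (hS : S.IsExact)
    (hT : T.IsExact) (φ : Hom S T)
    [IsIso φ.a] [IsIso φ.b] : IsIso φ.c := by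
  -- Exactness is known only for contravariant representables, so the five lemma is run on
  -- precomposition with `φ.c` and concluded by Yoneda.
  have surj {W : 𝒞} (x : C ⟶ W) : ∃ y, φ.c ≫ y = x := by
    obtain ⟨y, hy⟩ := hT.exact_B (inv φ.b ≫ S.i ≫ x) (by
      rw [← cancel_epi φ.a, ← φ.f_b_assoc]; simp)
    obtain ⟨t, ht⟩ := hS.exact_C (x - φ.c ≫ y) (by
      rw [Preadditive.comp_sub, φ.i_c_assoc, ← hy]; simp)
    refine ⟨y + T.q ≫ inv φ.a ≫ t, ?_⟩
    rw [Preadditive.comp_add, ← φ.q_a_assoc, IsIso.hom_inv_id_assoc, ← ht]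
    abel
  have inj {W : 𝒞} (x : C' ⟶ W) (hx : φ.c ≫ x = 0) : x = 0 := by
    obtain ⟨y, rfl⟩ := hT.exact_C x (by
      rw [← cancel_epi φ.b, ← φ.i_c_assoc, hx]; simp)
    obtain ⟨z, hz⟩ := hS.exact_A (φ.a ≫ y) (by rw [φ.q_a_assoc, hx])
    have : y = T.f ≫ inv φ.b ≫ z := by
      rw [← cancel_epi φ.a, hz, ← φ.f_b_assoc, IsIso.hom_inv_id_assoc]
    simp [this]
  obtain ⟨r, hr⟩ := surj (𝟙 _)
  refine ⟨r, hr, ?_⟩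
  rw [← sub_eq_zero]
  apply inj
  simp [reassoc_of% hr]

/-- The inverse of a morphism of three-periodic complexes with invertible components. -/
@[simps]
noncomputable def Hom.inv {S : CyclicComplex A B C} {T : CyclicComplex A' B' C'} (φ : Hom S T) [IsIso φ.a] [IsIso φ.b]
    [IsIso φ.c] : Hom T S where
  a := CategoryTheory.inv φ.a
  b := CategoryTheory.inv φ.b
  c := CategoryTheory.inv φ.c
  f_b := by rw [← cancel_epi φ.a, ← φ.f_b_assoc]; simp
  i_c := by rw [← cancel_epi φ.b, ← φ.i_c_assoc]; simp
  q_a := by rw [← cancel_epi φ.c, ← φ.q_a_assoc]; simp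

end CyclicComplex
end FreeTriangulation

/-! ### Normal form of morphisms -/

namespace FreeTriangulation

section

variable {𝒞 : Type u} [Category.{v} 𝒞] [Preadditive 𝒞]

namespace CyclicComplex

/-- The third object is the sum of the cokernel `N` and the kernel `M` of `k`, cut out by the
idempotents complementary to `l ≫ k` and `k ≫ l`. -/
theorem exists_isNullhomotopic_of_split [HasBinaryBiproducts 𝒞] [IsIdempotentComplete 𝒞]
    {K L : 𝒞} {k : K ⟶ L} {l : L ⟶ K} (hk : k ≫ l ≫ k = k) (hl : l ≫ k ≫ l = l) :
    ∃ (M : 𝒞) (T : CyclicComplex K L M), T.f = k ∧ T.IsNullhomotopic := by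
  obtain ⟨N, ι, π, hιπ, hπι⟩ := IsIdempotentComplete.idempotents_split L (𝟙 L - l ≫ k) (by
    simp [reassoc_of% hl])
  obtain ⟨M, ι', π', hιπ', hπι'⟩ := IsIdempotentComplete.idempotents_split K (𝟙 K - k ≫ l) (by
    simp [reassoc_of% hk])
  have h₁ : k ≫ π = 0 :=
    calc k ≫ π = k ≫ (π ≫ ι) ≫ π := by simp [hιπ]
      _ = 0 := by rw [hπι]; simp [reassoc_of% hk]
  have h₂ : ι' ≫ k = 0 :=
    calc ι' ≫ k = ι' ≫ (π' ≫ ι') ≫ k := by simp [reassoc_of% hιπ']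
      _ = 0 := by rw [hπι']; simp [hk]
  let T : CyclicComplex K L (N ⊞ M) :=
    { f := k
      i := biprod.lift π 0
      q := biprod.desc 0 ι'
      f_i := by apply biprod.hom_ext <;> simp [h₁]
      i_q := by simp
      q_f := by apply biprod.hom_ext' <;> simp [h₂] }
  refine ⟨N ⊞ M, T, rfl, l, biprod.desc ι 0, biprod.lift 0 π', ?_, ?_, ?_⟩
  · simp [T, hπι']
  · simp [T, hπι]
  · apply biprod.hom_ext' <;> apply biprod.hom_ext <;> simp [T, hιπ, hιπ']

end CyclicComplex

variable [IsTwoRegular 𝒞]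

namespace IsTwoRegular

/-- Regularity modulo `2` becomes exact after one correction: the defect consists of two terms that
agree modulo `4`, each a multiple of `2`, so their sum vanishes. -/
theorem comp_eq_of_comp_add_two_smul {X Y : 𝒞} {x : X ⟶ Y} {y : Y ⟶ X} {z : X ⟶ Y}
    (h : x ≫ y ≫ x + 2 • z = x) : (x ≫ y ≫ x) ≫ y ≫ x ≫ y ≫ x = x ≫ y ≫ x := by
  have e₁ := congr($h ≫ y ≫ x)
  have e₂ := congr(x ≫ y ≫ $h)
  have e₃ := congr(($h ≫ y ≫ x) ≫ y ≫ x)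
  have e₄ := four_smul (z ≫ y ≫ x)
  have e₅ := congr(2 • z ≫ y ≫ $h)
  simp only [Preadditive.add_comp, Preadditive.comp_add, Preadditive.nsmul_comp,
    Preadditive.comp_nsmul, assoc, nsmul_add] at *
  linear_combination (norm := module) e₁ + e₃ - e₅ - e₄ + four_smul (z ≫ y ≫ z)

/-- The correction is applied to `y ≫ x ≫ y`, with `x` as its inverse. Only one of the two
identities can be exact: a nonzero multiple of `2` has no exact generalized inverse. -/
theorem exists_inverse {X Y : 𝒞} (x : X ⟶ Y) :
    ∃ (y : Y ⟶ X) (z : X ⟶ Y), y ≫ x ≫ y = y ∧ x ≫ y ≫ x + 2 • z = x := by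
  obtain ⟨y, z, h⟩ := exists_inverse_mod_two x
  have h' : (y ≫ x ≫ y) ≫ x ≫ y ≫ x ≫ y + 2 • (y ≫ z ≫ y + y ≫ z ≫ y ≫ x ≫ y) =
      y ≫ x ≫ y := by
    have e₁ := congr(y ≫ $h ≫ y ≫ x ≫ y)
    have e₂ := congr(y ≫ $h ≫ y)
    simp only [Preadditive.add_comp, Preadditive.comp_add, Preadditive.nsmul_comp,
      Preadditive.comp_nsmul, assoc, nsmul_add] at *
    linear_combination (norm := module) e₁ + e₂
  refine ⟨(y ≫ x ≫ y) ≫ x ≫ y ≫ x ≫ y, z + z ≫ y ≫ x, ?_, ?_⟩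
  · simpa only [assoc] using comp_eq_of_comp_add_two_smul h'
  · have e₁ := congr($h ≫ y ≫ x)
    have e₂ := congr($(comp_eq_of_comp_add_two_smul h) ≫ y ≫ x)
    simp only [Preadditive.add_comp, Preadditive.nsmul_comp, assoc, nsmul_add] at *
    linear_combination (norm := module) e₁ + e₂ + h

/-- Up to isomorphism, every morphism is the sum of a split morphism and multiplication by `2`. -/
theorem exists_iso_map_two [HasBinaryBiproducts 𝒞] [IsIdempotentComplete 𝒞] {A B : 𝒞}
    (f : A ⟶ B) :
    ∃ (K L X : 𝒞) (k : K ⟶ L) (l : L ⟶ K) (α : A ≅ K ⊞ X) (β : B ≅ L ⊞ X),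
      k ≫ l ≫ k = k ∧ l ≫ k ≫ l = l ∧ f ≫ β.hom = α.hom ≫ biprod.map k (2 • 𝟙 X) := by
  -- Here `f ≫ g ≫ f` is the split part and `2 • z` the remainder. The remainder is compressed to
  -- the complements of the split part, and `z` is replaced there by a morphism `x` with exact
  -- inverse `y`; replacing `z` modulo `2` does not change `2 • z`.
  obtain ⟨g, z, hg, hz⟩ := exists_inverse f
  obtain ⟨y₀, w, hy₀, hw⟩ := exists_inverse ((𝟙 A - f ≫ g) ≫ z ≫ (𝟙 B - g ≫ f))
  obtain ⟨x, hx⟩ : ∃ x, x = (𝟙 A - f ≫ g) ≫ (z ≫ (𝟙 B - g ≫ f) ≫ y₀ ≫ (𝟙 A - f ≫ g) ≫ z) ≫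
    (𝟙 B - g ≫ f) := ⟨_, rfl⟩
  obtain ⟨y, hy⟩ : ∃ y, y = (𝟙 B - g ≫ f) ≫ y₀ ≫ (𝟙 A - f ≫ g) := ⟨_, rfl⟩
  have p₁ : g ≫ (𝟙 A - f ≫ g) = 0 := by simp [hg]
  have p₂ : (𝟙 B - g ≫ f) ≫ g = 0 := by simp [hg]
  have p₃ : (𝟙 A - f ≫ g) ≫ (𝟙 A - f ≫ g) = 𝟙 A - f ≫ g := by simp [hg]
  have p₄ : (𝟙 B - g ≫ f) ≫ (𝟙 B - g ≫ f) = 𝟙 B - g ≫ f := by simp [reassoc_of% hg]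
  have p₅ : (𝟙 A - f ≫ g) ≫ f ≫ g = 0 := by simp [hg]
  have p₆ : g ≫ f ≫ (𝟙 B - g ≫ f) = 0 := by simp [reassoc_of% hg]
  have p₇ : f ≫ (𝟙 B - g ≫ f) = 2 • z := by
    simp only [Preadditive.comp_sub, comp_id]
    linear_combination (norm := module) -hz
  have p₈ : (𝟙 A - f ≫ g) ≫ f = 2 • z := by
    simp only [Preadditive.sub_comp, id_comp, assoc]
    linear_combination (norm := module) -hz
  generalize 𝟙 A - f ≫ g = p at *
  generalize 𝟙 B - g ≫ f = r at *
  simp only [assoc] at hy₀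
  have hxyx : x ≫ y ≫ x = x := by
    simp only [hx, hy, assoc, reassoc_of% p₃, reassoc_of% p₄]
    simp only [reassoc_of% hy₀]
  have hyxy : y ≫ x ≫ y = y := by
    simp only [hx, hy, assoc, reassoc_of% p₃, reassoc_of% p₄]
    simp only [reassoc_of% hy₀]
  have hgx : g ≫ x = 0 := by simp [hx, reassoc_of% p₁]
  have hxg : x ≫ g = 0 := by simp [hx, p₂]
  have hyg : y ≫ f ≫ g = 0 := by simp [hy, p₅]
  have hgy : g ≫ f ≫ y = 0 := by simp [hy, reassoc_of% p₆]
  have fx : f = f ≫ g ≫ f + 2 • x := by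
    have e₁ : 2 • p ≫ z ≫ r = 2 • z :=
      calc 2 • p ≫ z ≫ r = p ≫ (2 • z) ≫ r := by simp
        _ = p ≫ (f ≫ r) ≫ r := by rw [p₇]
        _ = (p ≫ f) ≫ r := by simp [p₄]
        _ = (2 • z) ≫ r := by rw [p₈]
        _ = (f ≫ r) ≫ r := by rw [p₇]
        _ = 2 • z := by rw [assoc, p₄, p₇]
    have e₂ : x + 2 • w = p ≫ z ≫ r := by simpa only [hx, assoc] using hw
    linear_combination (norm := module) -hz - (2 : ℤ) • e₂ - e₁ + four_smul w
  clear hx hy p₁ p₂ p₃ p₄ p₅ p₆ p₇ p₈ hw hz hy₀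
  -- The morphisms `x` and `y` identify the summands of `A` and `B` cut out by `x ≫ y` and `y ≫ x`;
  -- on this common summand `X`, `f` is multiplication by `2`.
  obtain ⟨X, ι, π, hιπ, hπι⟩ := IsIdempotentComplete.idempotents_split A (x ≫ y) (by
    simp [reassoc_of% hxyx])
  obtain ⟨K, ι₁, π₁, hιπ₁, hπι₁⟩ := IsIdempotentComplete.idempotents_split A (𝟙 A - x ≫ y) (by
    simp [reassoc_of% hxyx])
  obtain ⟨L, ι₂, π₂, hιπ₂, hπι₂⟩ := IsIdempotentComplete.idempotents_split B (𝟙 B - y ≫ x) (by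
    simp [reassoc_of% hyxy])
  have hxπ : x ≫ π₂ = 0 :=
    calc x ≫ π₂ = x ≫ (π₂ ≫ ι₂) ≫ π₂ := by simp [hιπ₂]
      _ = 0 := by rw [hπι₂]; simp [reassoc_of% hxyx]
  have hyπ : y ≫ π₁ = 0 :=
    calc y ≫ π₁ = y ≫ (π₁ ≫ ι₁) ≫ π₁ := by simp [hιπ₁]
      _ = 0 := by rw [hπι₁]; simp [reassoc_of% hyxy]
  have hιx : ι₁ ≫ x = 0 :=
    calc ι₁ ≫ x = ι₁ ≫ (π₁ ≫ ι₁) ≫ x := by simp [reassoc_of% hιπ₁]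
      _ = 0 := by rw [hπι₁]; simp [hxyx]
  have hιy : ι₂ ≫ y = 0 :=
    calc ι₂ ≫ y = ι₂ ≫ (π₂ ≫ ι₂) ≫ y := by simp [reassoc_of% hιπ₂]
      _ = 0 := by rw [hπι₂]; simp [hyxy]
  have hxyπ : x ≫ y ≫ π = π := by
    rw [← assoc, ← hπι, assoc, hιπ, comp_id]
  have hιxy : ι ≫ x ≫ y = ι := by
    rw [← hπι, reassoc_of% hιπ]
  have hι₁π : ι₁ ≫ π = 0 := by rw [← hxyπ, reassoc_of% hιx, zero_comp]
  have hιπ₁' : ι ≫ π₁ = 0 := by rw [← hιxy, assoc, assoc, hyπ, comp_zero, comp_zero]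
  have fy : f ≫ y = 2 • π ≫ ι := by
    calc f ≫ y = (f ≫ g ≫ f + 2 • x) ≫ y := by rw [← fx]
      _ = 2 • π ≫ ι := by simp [hgy, hπι]
  have yf : y ≫ f = 2 • y ≫ x := by
    calc y ≫ f = y ≫ (f ≫ g ≫ f + 2 • x) := by rw [← fx]
      _ = 2 • y ≫ x := by simp [reassoc_of% hyg]
  have hk : ι₁ ≫ f ≫ g ≫ f ≫ π₂ = ι₁ ≫ f ≫ π₂ := by
    calc ι₁ ≫ f ≫ g ≫ f ≫ π₂ = ι₁ ≫ (f ≫ g ≫ f + 2 • x) ≫ π₂ := by simp [hxπ]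
      _ = ι₁ ≫ f ≫ π₂ := by rw [← fx]
  refine ⟨K, L, X, ι₁ ≫ f ≫ π₂, ι₂ ≫ g ≫ π₁,
    { hom := biprod.lift π₁ π
      inv := biprod.desc ι₁ ι
      hom_inv_id := by simp [hπι, hπι₁]
      inv_hom_id := by apply biprod.hom_ext' <;> apply biprod.hom_ext <;> simp [*] },
    { hom := biprod.lift π₂ (y ≫ π)
      inv := biprod.desc ι₂ (ι ≫ x)
      hom_inv_id := by simp [hπι₂, reassoc_of% hπι, reassoc_of% hyxy]
      inv_hom_id := by
        apply biprod.hom_ext' <;> apply biprod.hom_ext <;>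
          simp [hιπ₂, hxπ, reassoc_of% hιy, hxyπ, hιπ] }, ?_, ?_, ?_⟩
  · simp [reassoc_of% hπι₁, reassoc_of% hπι₂, reassoc_of% hxg, reassoc_of% hgx, hk]
  · simp [reassoc_of% hπι₁, reassoc_of% hπι₂, reassoc_of% hxg, reassoc_of% hgx, reassoc_of% hg]
  · apply biprod.hom_ext
    · simp [reassoc_of% hπι₁, reassoc_of% yf, hxπ]
    · simp [reassoc_of% fy, hιπ]

end IsTwoRegular

namespace CyclicComplex

/-- Every morphism is the first differential of an exact complex. -/
theorem exists_isExact [HasBinaryBiproducts 𝒞] [IsIdempotentComplete 𝒞] {A B : 𝒞} (f : A ⟶ B) :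
    ∃ (C : 𝒞) (T : CyclicComplex A B C), T.f = f ∧ T.IsExact := by
  obtain ⟨K, L, X, k, l, α, β, hk, hl, h⟩ := IsTwoRegular.exists_iso_map_two f
  obtain ⟨M, T, rfl, hT⟩ := exists_isNullhomotopic_of_split hk hl
  have hf : f = α.hom ≫ biprod.map T.f (2 • 𝟙 X) ≫ β.inv := by simp [← reassoc_of% h]
  have e := (hT.isExact.sum (isExact_two X))
  refine ⟨M ⊞ X, ⟨f, β.hom ≫ (T.sum (two X)).i, (T.sum (two X)).q ≫ α.inv, ?_, ?_, ?_⟩, rfl,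
    e.of_retract ⟨α.hom, β.hom, 𝟙 _, h, by simp, by simp⟩
      ⟨α.inv, β.inv, 𝟙 _, by simp [hf], by simp, by simp⟩ (by simp) (by simp) (by simp)⟩
  · rw [reassoc_of% h]
    simp only [← sum_f, ← two_f X, f_i, comp_zero]
  · simp only [assoc, i_q_assoc, comp_zero]
  · simp only [hf, assoc, Iso.inv_hom_id_assoc]
    exact (T.sum (two X)).q_f_assoc β.inv

/-- An exact complex is the direct sum of a contractible complex and a complex `two X`. -/
theorem IsExact.exists_hom_sum [HasBinaryBiproducts 𝒞] [IsIdempotentComplete 𝒞] {A B C : 𝒞}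
    {T : CyclicComplex A B C} (hT : T.IsExact) :
    ∃ (K L M X : 𝒞) (S : CyclicComplex K L M) (φ : Hom T (S.sum (two X))),
      S.IsNullhomotopic ∧ IsIso φ.a ∧ IsIso φ.b ∧ IsIso φ.c := by
  obtain ⟨K, L, X, k, l, α, β, hk, hl, h⟩ := IsTwoRegular.exists_iso_map_two T.f
  obtain ⟨M, S, rfl, hS⟩ := exists_isNullhomotopic_of_split hk hl
  obtain ⟨φ, h₁, h₂⟩ := hT.exists_hom_sum_two hS α.hom β.hom h
  have : IsIso φ.a := h₁ ▸ inferInstance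
  have : IsIso φ.b := h₂ ▸ inferInstance
  exact ⟨K, L, M, X, S, φ, hS, inferInstance, inferInstance,
    φ.isIso_c hT (hS.isExact.sum (isExact_two X))⟩

end CyclicComplex

end

end FreeTriangulation

/-! ### Mapping cones and the octahedron -/

namespace FreeTriangulation
namespace CyclicComplex

variable {𝒞 : Type u} [Category.{v} 𝒞] [Preadditive 𝒞] {A B C A' B' C' A'' B'' C'' X Y : 𝒞}

/-- The composition of morphisms of three-periodic complexes. -/
@[simps]
def Hom.comp {S : CyclicComplex A B C} {T : CyclicComplex A' B' C'} {U : CyclicComplex A'' B'' C''}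
    (φ : Hom S T) (ψ : Hom T U) : Hom S U where
  a := φ.a ≫ ψ.a
  b := φ.b ≫ ψ.b
  c := φ.c ≫ ψ.c
  f_b := by rw [φ.f_b_assoc, ψ.f_b, assoc]
  i_c := by rw [φ.i_c_assoc, ψ.i_c, assoc]
  q_a := by rw [φ.q_a_assoc, ψ.q_a, assoc]

variable [IsTwoRegular 𝒞]

/-- The morphism `two X ⟶ two Y` all of whose components are a given morphism `X ⟶ Y`. -/
@[simps]
def twoMap (e : X ⟶ Y) : Hom (two X) (two Y) where
  a := e
  b := e
  c := e

/-- A strong deformation retraction of a three-periodic complex onto `two X`. -/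
structure TwoDeformation (T : CyclicComplex A B C) (X : 𝒞) where
  π : Hom T (two X)
  σ : Hom (two X) T
  h₁ : B ⟶ A
  h₂ : C ⟶ B
  h₃ : A ⟶ C
  σ_π_a : σ.a ≫ π.a = 𝟙 X
  σ_π_b : σ.b ≫ π.b = 𝟙 X
  σ_π_c : σ.c ≫ π.c = 𝟙 X
  π_σ_a : π.a ≫ σ.a + (T.f ≫ h₁ + h₃ ≫ T.q) = 𝟙 A
  π_σ_b : π.b ≫ σ.b + (T.i ≫ h₂ + h₁ ≫ T.f) = 𝟙 B
  π_σ_c : π.c ≫ σ.c + (T.q ≫ h₃ + h₂ ≫ T.i) = 𝟙 C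
  h₁_π : h₁ ≫ π.a = 0
  h₂_π : h₂ ≫ π.b = 0
  h₃_π : h₃ ≫ π.c = 0
  σ_h₁ : σ.b ≫ h₁ = 0
  σ_h₂ : σ.c ≫ h₂ = 0
  σ_h₃ : σ.a ≫ h₃ = 0

variable [HasBinaryBiproducts 𝒞]

/-- Allows morphisms of exact complexes to be replaced, up to homotopy, by morphisms between
complexes `two X`. -/
theorem nonempty_twoDeformation_of_iso {S : CyclicComplex A B C} {T : CyclicComplex A' B' C'}
    (hT : T.IsNullhomotopic) (φ : Hom S (T.sum (two X))) [IsIso φ.a] [IsIso φ.b] [IsIso φ.c] :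
    Nonempty (TwoDeformation S X) := by
  obtain ⟨h₁, h₂, h₃, hA, hB, hC⟩ := hT
  have comm₁ := φ.inv.f_b
  have comm₂ := φ.inv.i_c
  have comm₃ := φ.inv.q_a
  simp only [Hom.inv_a, Hom.inv_b, Hom.inv_c] at comm₁ comm₂ comm₃
  exact ⟨{
    π := φ.comp ⟨biprod.snd, biprod.snd, biprod.snd, by simp, by simp, by simp⟩
    σ := Hom.comp (T := T.sum (two X)) ⟨biprod.inr, biprod.inr, biprod.inr, by simp, by simp,
      by simp⟩ φ.inv
    h₁ := φ.b ≫ biprod.fst ≫ h₁ ≫ biprod.inl ≫ inv φ.a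
    h₂ := φ.c ≫ biprod.fst ≫ h₂ ≫ biprod.inl ≫ inv φ.b
    h₃ := φ.a ≫ biprod.fst ≫ h₃ ≫ biprod.inl ≫ inv φ.c
    σ_π_a := by simp
    σ_π_b := by simp
    σ_π_c := by simp
    π_σ_a := by
      have e₁ := congr(φ.a ≫ (biprod.fst ≫ $hA ≫ biprod.inl + biprod.snd ≫ biprod.inr) ≫ inv φ.a)
      have e₂ := congr(φ.a ≫ $(biprod.total) ≫ inv φ.a)
      simp only [Preadditive.add_comp, Preadditive.comp_add, assoc, id_comp,
        IsIso.hom_inv_id] at e₁ e₂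
      simp only [Hom.comp_a, φ.f_b_assoc, ← comm₃, sum_f, sum_q, biprod.map_fst_assoc,
        biprod.inl_map_assoc, assoc, Hom.inv_a]
      linear_combination (norm := module) e₁ + e₂
    π_σ_b := by
      have e₁ := congr(φ.b ≫ (biprod.fst ≫ $hB ≫ biprod.inl + biprod.snd ≫ biprod.inr) ≫ inv φ.b)
      have e₂ := congr(φ.b ≫ $(biprod.total) ≫ inv φ.b)
      simp only [Preadditive.add_comp, Preadditive.comp_add, assoc, id_comp,
        IsIso.hom_inv_id] at e₁ e₂
      simp only [Hom.comp_b, φ.i_c_assoc, ← comm₁, sum_i, sum_f, biprod.map_fst_assoc,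
        biprod.inl_map_assoc, assoc, Hom.inv_b]
      linear_combination (norm := module) e₁ + e₂
    π_σ_c := by
      have e₁ := congr(φ.c ≫ (biprod.fst ≫ $hC ≫ biprod.inl + biprod.snd ≫ biprod.inr) ≫ inv φ.c)
      have e₂ := congr(φ.c ≫ $(biprod.total) ≫ inv φ.c)
      simp only [Preadditive.add_comp, Preadditive.comp_add, assoc, id_comp,
        IsIso.hom_inv_id] at e₁ e₂
      simp only [Hom.comp_c, φ.q_a_assoc, ← comm₂, sum_q, sum_i, biprod.map_fst_assoc,
        biprod.inl_map_assoc, assoc, Hom.inv_c]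
      linear_combination (norm := module) e₁ + e₂
    h₁_π := by simp
    h₂_π := by simp
    h₃_π := by simp
    σ_h₁ := by simp
    σ_h₂ := by simp
    σ_h₃ := by simp }⟩

/-- The mapping cone of a morphism of three-periodic complexes. -/
@[simps]
noncomputable def cone {S : CyclicComplex A B C} {T : CyclicComplex A' B' C'} (φ : Hom S T) :
    CyclicComplex (B ⊞ A') (C ⊞ B') (A ⊞ C') where
  f := biprod.desc (biprod.lift (-S.i) φ.b) (biprod.lift 0 T.f)
  i := biprod.desc (biprod.lift (-S.q) φ.c) (biprod.lift 0 T.i)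
  q := biprod.desc (biprod.lift (-S.f) φ.a) (biprod.lift 0 T.q)
  f_i := by apply biprod.hom_ext' <;> apply biprod.hom_ext <;> simp [φ.i_c]
  i_q := by apply biprod.hom_ext' <;> apply biprod.hom_ext <;> simp [φ.q_a]
  q_f := by apply biprod.hom_ext' <;> apply biprod.hom_ext <;> simp [φ.f_b]

/-- Unipotent matrices built from the homotopy are inverse isomorphisms between the cones. -/
theorem isExact_cone_of_homotopy {S : CyclicComplex A B C} {T : CyclicComplex A' B' C'}
    {φ ψ : Hom S T} (hψ : (cone ψ).IsExact) (h₁ : B ⟶ A') (h₂ : C ⟶ B') (h₃ : A ⟶ C')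
    (ha : φ.a = ψ.a + (S.f ≫ h₁ + h₃ ≫ T.q)) (hb : φ.b = ψ.b + (S.i ≫ h₂ + h₁ ≫ T.f))
    (hc : φ.c = ψ.c + (S.q ≫ h₃ + h₂ ≫ T.i)) : (cone φ).IsExact := by
  refine hψ.of_retract
    ⟨biprod.desc (biprod.lift (𝟙 B) h₁) (biprod.lift 0 (𝟙 A')),
      biprod.desc (biprod.lift (𝟙 C) h₂) (biprod.lift 0 (𝟙 B')),
      biprod.desc (biprod.lift (𝟙 A) h₃) (biprod.lift 0 (𝟙 C')), ?_, ?_, ?_⟩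
    ⟨biprod.desc (biprod.lift (𝟙 B) (-h₁)) (biprod.lift 0 (𝟙 A')),
      biprod.desc (biprod.lift (𝟙 C) (-h₂)) (biprod.lift 0 (𝟙 B')),
      biprod.desc (biprod.lift (𝟙 A) (-h₃)) (biprod.lift 0 (𝟙 C')), ?_, ?_, ?_⟩ ?_ ?_ ?_ <;>
  apply biprod.hom_ext' <;> apply biprod.hom_ext <;> simp [ha, hb, hc] <;> abel

theorem isExact_cone_twoMap {e : X ⟶ Y} {e' : Y ⟶ X} (he : e ≫ e' ≫ e = e) :
    (cone (twoMap e)).IsExact := by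
  have four := fun {X Y : 𝒞} (x : X ⟶ Y) ↦ IsTwoRegular.four_smul x
  -- All three differentials of this cone are the same matrix, so one computation serves three
  -- times. Regularity of `e` is needed only for `fill`.
  have key {W : 𝒞} (x : X ⊞ Y ⟶ W)
      (hx : biprod.desc (biprod.lift (-(2 • 𝟙 X)) e) (biprod.lift 0 (2 • 𝟙 Y)) ≫ x = 0) :
      ∃ y, x = biprod.desc (biprod.lift (-(2 • 𝟙 X)) e) (biprod.lift 0 (2 • 𝟙 Y)) ≫ y := by
    have h₁ := congr(biprod.inl ≫ $hx)
    have h₂ := congr(biprod.inr ≫ $hx)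
    obtain ⟨β, hβ⟩ : ∃ β, β = biprod.inl ≫ x := ⟨_, rfl⟩
    obtain ⟨α, hα⟩ : ∃ α, α = biprod.inr ≫ x := ⟨_, rfl⟩
    have hx' : x = biprod.desc β α := by apply biprod.hom_ext' <;> simp [hβ, hα]
    simp only [hx', biprod.inl_desc_assoc, biprod.inr_desc_assoc, biprod.lift_desc, comp_zero,
      zero_comp, Preadditive.neg_comp, Preadditive.nsmul_comp, id_comp, zero_add] at h₁ h₂
    obtain ⟨α', rfl⟩ := IsTwoRegular.exists_eq_two_smul α h₂
    obtain ⟨β', hβ'⟩ := IsTwoRegular.exists_eq_two_smul (β + e ≫ α') (by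
      rw [Preadditive.comp_nsmul] at h₁
      linear_combination (norm := module) h₁ + four β)
    refine ⟨biprod.desc (e ≫ α' - β') α', ?_⟩
    rw [hx']
    apply biprod.hom_ext'
    · simp only [biprod.inl_desc, biprod.inl_desc_assoc, biprod.lift_desc, Preadditive.neg_comp,
        Preadditive.nsmul_comp, id_comp]
      linear_combination (norm := module) hβ'
    · simp
  refine ⟨key, key, key, fun {W} u v huv ↦ ?_⟩
  have h₁ := congr(biprod.inl ≫ $huv)
  have h₂ := congr(biprod.inr ≫ $huv)
  obtain ⟨β, hβ⟩ : ∃ β, β = biprod.inl ≫ u := ⟨_, rfl⟩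
  obtain ⟨a, ha⟩ : ∃ a, a = biprod.inr ≫ u := ⟨_, rfl⟩
  obtain ⟨γ, hγ⟩ : ∃ γ, γ = biprod.inl ≫ v := ⟨_, rfl⟩
  obtain ⟨b, hb⟩ : ∃ b, b = biprod.inr ≫ v := ⟨_, rfl⟩
  obtain rfl : u = biprod.desc β a := by apply biprod.hom_ext' <;> simp [hβ, ha]
  obtain rfl : v = biprod.desc γ b := by apply biprod.hom_ext' <;> simp [hγ, hb]
  simp only [cone_f, two_i, two_f, twoMap_b, biprod.inl_desc_assoc, biprod.inr_desc_assoc,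
    biprod.lift_desc, zero_comp, Preadditive.neg_comp, Preadditive.nsmul_comp, id_comp, zero_add,
    Preadditive.comp_nsmul, biprod.inl_desc, biprod.inr_desc] at h₁ h₂
  obtain ⟨d, hd⟩ := IsTwoRegular.exists_eq_two_smul (a - b) (by
    linear_combination (norm := module) -h₂)
  have hab := congr(e ≫ $hd)
  have hδ := congr(e ≫ e' ≫ $h₁)
  simp only [Preadditive.comp_sub, Preadditive.comp_nsmul, Preadditive.comp_add,
    Preadditive.comp_neg, reassoc_of% he] at hab hδ
  -- Since `e ≫ b = 2 • (β + γ)`, regularity gives `2 • e ≫ e' ≫ (β + γ) = 2 • (β + γ)`, which is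
  -- what the second component must contribute after composition with `e`.
  refine ⟨biprod.desc (e ≫ e' ≫ (β + γ) + e ≫ d - β) (a + 2 • e' ≫ (β + γ)), ?_, ?_⟩
  · apply biprod.hom_ext'
    · simp
      linear_combination (norm := module) hab + h₁ + four β
    · simp
      linear_combination (norm := module) four (e' ≫ β) + four (e' ≫ γ) - h₂
  · apply biprod.hom_ext'
    · simp
      linear_combination (norm := module) hab + hδ
    · simp
      linear_combination (norm := module) four (e' ≫ β) + four (e' ≫ γ)

/-- The deformations make this cone a homotopy retract of the cone of `twoMap e`; their side
conditions kill the mixed terms. -/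
theorem isExact_cone_of_factor {S : CyclicComplex A B C} {T : CyclicComplex A' B' C'}
    (δ : TwoDeformation S X) (δ' : TwoDeformation T Y) {e : X ⟶ Y} {e' : Y ⟶ X}
    (he : e ≫ e' ≫ e = e) : (cone (δ.π.comp ((twoMap e).comp δ'.σ))).IsExact := by
  have c₁ := δ.π.f_b
  have c₂ := δ.π.i_c
  have c₃ := δ.π.q_a
  have c₄ := δ'.π.f_b
  have c₅ := δ'.π.i_c
  have c₆ := δ'.π.q_a
  have d₁ := δ.σ.f_b
  have d₂ := δ.σ.i_c
  have d₃ := δ.σ.q_a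
  have d₄ := δ'.σ.f_b
  have d₅ := δ'.σ.i_c
  have d₆ := δ'.σ.q_a
  simp only [two_f, two_i, two_q, Preadditive.comp_nsmul, Preadditive.nsmul_comp, comp_id,
    id_comp] at c₁ c₂ c₃ c₄ c₅ c₆ d₁ d₂ d₃ d₄ d₅ d₆
  refine (isExact_cone_twoMap he).of_homotopyRetract
    ⟨biprod.map δ.π.b δ'.π.a, biprod.map δ.π.c δ'.π.b, biprod.map δ.π.a δ'.π.c, ?_, ?_, ?_⟩
    ⟨biprod.map δ.σ.b δ'.σ.a, biprod.map δ.σ.c δ'.σ.b, biprod.map δ.σ.a δ'.σ.c, ?_, ?_, ?_⟩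
    (biprod.map (-δ.h₂) δ'.h₁) (biprod.map (-δ.h₃) δ'.h₂) (biprod.map (-δ.h₁) δ'.h₃) ?_ ?_ ?_
  · apply biprod.hom_ext' <;> apply biprod.hom_ext <;>
      simp [c₂, c₄, δ'.σ_π_b]
  · apply biprod.hom_ext' <;> apply biprod.hom_ext <;>
      simp [c₃, c₅, δ'.σ_π_c]
  · apply biprod.hom_ext' <;> apply biprod.hom_ext <;>
      simp [c₁, c₆, δ'.σ_π_a]
  · apply biprod.hom_ext' <;> apply biprod.hom_ext <;>
      simp [d₂, d₄, reassoc_of% δ.σ_π_b]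
  · apply biprod.hom_ext' <;> apply biprod.hom_ext <;>
      simp [d₃, d₅, reassoc_of% δ.σ_π_c]
  · apply biprod.hom_ext' <;> apply biprod.hom_ext <;>
      simp [d₁, d₆, reassoc_of% δ.σ_π_a]
  · apply biprod.hom_ext' <;> apply biprod.hom_ext <;>
      simp [δ.π_σ_b, δ'.π_σ_a, δ'.σ_h₁, reassoc_of% δ.h₁_π]
  · apply biprod.hom_ext' <;> apply biprod.hom_ext <;>
      simp [δ.π_σ_c, δ'.π_σ_b, δ'.σ_h₂, reassoc_of% δ.h₂_π]
  · apply biprod.hom_ext' <;> apply biprod.hom_ext <;>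
      simp [δ.π_σ_a, δ'.π_σ_c, δ'.σ_h₃, reassoc_of% δ.h₃_π]

variable [IsIdempotentComplete 𝒞]

theorem IsExact.nonempty_twoDeformation {T : CyclicComplex A B C} (hT : T.IsExact) :
    ∃ X : 𝒞, Nonempty (TwoDeformation T X) := by
  obtain ⟨K, L, M, X, S, φ, hS, _, _, _⟩ := hT.exists_hom_sum
  exact ⟨X, nonempty_twoDeformation_of_iso hS φ⟩

/-- Commutative squares between exact complexes extend to morphisms of complexes. -/
theorem IsExact.exists_hom {S : CyclicComplex A B C} {T : CyclicComplex A' B' C'}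
    (hS : S.IsExact) (hT : T.IsExact) (a : A ⟶ A') (b : B ⟶ B') (hab : S.f ≫ b = a ≫ T.f) :
    ∃ φ : Hom S T, φ.a = a ∧ φ.b = b := by
  obtain ⟨K, L, M, X, U, φ, hU, _, _, _⟩ := hT.exists_hom_sum
  obtain ⟨ψ, h₁, h₂⟩ := hS.exists_hom_sum_two hU (a ≫ φ.a) (b ≫ φ.b) (by
    rw [reassoc_of% hab, φ.f_b, assoc])
  exact ⟨ψ.comp φ.inv, by simp [h₁], by simp [h₂]⟩

/-- Commutative squares between exact complexes extend to morphisms with exact mapping cone. -/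
theorem IsExact.exists_hom_cone {S : CyclicComplex A B C} {T : CyclicComplex A' B' C'}
    (hS : S.IsExact) (hT : T.IsExact) (a : A ⟶ A') (b : B ⟶ B') (hab : S.f ≫ b = a ≫ T.f) :
    ∃ φ : Hom S T, φ.a = a ∧ φ.b = b ∧ (cone φ).IsExact := by
  obtain ⟨X, ⟨δ⟩⟩ := hS.nonempty_twoDeformation
  obtain ⟨Y, ⟨δ'⟩⟩ := hT.nonempty_twoDeformation
  obtain ⟨φ, rfl, rfl⟩ := hS.exists_hom hT a b hab
  obtain ⟨g, z, hg, hz⟩ := IsTwoRegular.exists_inverse (δ.σ.a ≫ φ.a ≫ δ'.π.a)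
  have hab' := (δ.σ.comp (φ.comp δ'.π)).f_b
  simp only [two_f, Preadditive.nsmul_comp, id_comp, Preadditive.comp_nsmul, comp_id,
    Hom.comp_a, Hom.comp_b] at hab'
  -- The first two components of the compressed morphism `two X ⟶ two Y` agree modulo `2`, so both
  -- are congruent to a single regular `e`.
  obtain ⟨w, hw⟩ := IsTwoRegular.exists_eq_two_smul
    (δ.σ.b ≫ φ.b ≫ δ'.π.b - δ.σ.a ≫ φ.a ≫ δ'.π.a) (by rw [nsmul_sub, hab', sub_self])
  obtain ⟨e, he⟩ : ∃ e, e = (δ.σ.a ≫ φ.a ≫ δ'.π.a) ≫ g ≫ δ.σ.a ≫ φ.a ≫ δ'.π.a := ⟨_, rfl⟩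
  have hege : e ≫ g ≫ e = e := by
    simp only [he, assoc] at hg ⊢
    simp only [reassoc_of% hg]
  rw [← he] at hz
  obtain ⟨ψ, hψ⟩ : ∃ ψ, ψ = δ.π.comp ((twoMap e).comp δ'.σ) := ⟨_, rfl⟩
  -- The homotopy combines those of the two deformations with `z` and `w`: multiples of `2` are
  -- boundaries because the differentials of `two` are `2`.
  obtain ⟨H₁, hH₁⟩ : ∃ H, H = δ.h₁ ≫ φ.a + δ.π.b ≫ δ.σ.b ≫ φ.b ≫ δ'.h₁ +
    δ.π.b ≫ z ≫ δ'.σ.a := ⟨_, rfl⟩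
  obtain ⟨H₂, hH₂⟩ : ∃ H, H = δ.h₂ ≫ φ.b + δ.π.c ≫ δ.σ.c ≫ φ.c ≫ δ'.h₂ +
    δ.π.c ≫ w ≫ δ'.σ.b := ⟨_, rfl⟩
  obtain ⟨H₃, hH₃⟩ : ∃ H, H = δ.h₃ ≫ φ.c + δ.π.a ≫ δ.σ.a ≫ φ.a ≫ δ'.h₃ := ⟨_, rfl⟩
  have πf {W : 𝒞} (x : X ⟶ W) : S.f ≫ δ.π.b ≫ x = 2 • δ.π.a ≫ x := by simp [δ.π.f_b_assoc]
  have πi {W : 𝒞} (x : X ⟶ W) : S.i ≫ δ.π.c ≫ x = 2 • δ.π.b ≫ x := by simp [δ.π.i_c_assoc]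
  have σf {W : 𝒞} (x : B ⟶ W) : δ.σ.a ≫ S.f ≫ x = 2 • δ.σ.b ≫ x := by simp [← δ.σ.f_b_assoc]
  have σi {W : 𝒞} (x : C ⟶ W) : δ.σ.b ≫ S.i ≫ x = 2 • δ.σ.c ≫ x := by simp [← δ.σ.i_c_assoc]
  have σf' : δ'.σ.a ≫ T.f = 2 • δ'.σ.b := by simp [← δ'.σ.f_b]
  have ha : φ.a = ψ.a + (S.f ≫ H₁ + H₃ ≫ T.q) := by
    have e₁ := congr($(δ.π_σ_a) ≫ φ.a)
    have e₂ := congr(δ.π.a ≫ δ.σ.a ≫ φ.a ≫ $(δ'.π_σ_a))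
    have e₃ := congr(δ.π.a ≫ $hz ≫ δ'.σ.a)
    simp only [hψ, hH₁, hH₃, Preadditive.add_comp, Preadditive.comp_add, Preadditive.nsmul_comp,
      Preadditive.comp_nsmul, assoc, id_comp, comp_id, Hom.comp_a, twoMap_a, πf, σf,
      ← φ.f_b_assoc, ← φ.q_a] at e₁ e₂ e₃ ⊢
    linear_combination (norm := module) -e₁ - e₂ - e₃
  have hb : φ.b = ψ.b + (S.i ≫ H₂ + H₁ ≫ T.f) := by
    have e₁ := congr($(δ.π_σ_b) ≫ φ.b)
    have e₂ := congr(δ.π.b ≫ δ.σ.b ≫ φ.b ≫ $(δ'.π_σ_b))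
    have e₃ := congr(δ.π.b ≫ $hz ≫ δ'.σ.b)
    have e₄ := congr(δ.π.b ≫ $hw ≫ δ'.σ.b)
    simp only [hψ, hH₁, hH₂, Preadditive.add_comp, Preadditive.comp_add, Preadditive.sub_comp,
      Preadditive.comp_sub, Preadditive.nsmul_comp, Preadditive.comp_nsmul, assoc, id_comp,
      comp_id, Hom.comp_b, twoMap_b, πi, σi, σf', ← φ.i_c_assoc, ← φ.f_b] at e₁ e₂ e₃ e₄ ⊢
    linear_combination (norm := module) -e₁ - e₂ - e₃ + e₄
  -- The old third component is discarded in favour of the one homotopic to `ψ.c` by construction.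
  refine ⟨⟨φ.a, φ.b, ψ.c + (S.q ≫ H₃ + H₂ ≫ T.i), hab, ?_, ?_⟩, rfl, rfl,
    isExact_cone_of_homotopy (hψ ▸ isExact_cone_of_factor δ δ' hege) H₁ H₂ H₃ ha hb rfl⟩
  · simp [hb, ψ.i_c]
  · simp [ha, ψ.q_a]

variable {Z P Q N : 𝒞}

/-- Splitting the identity of `X` off the cone of `T₁₂ ⟶ T₁₃` leaves the exact complex `Y ⟶ P ⊞ Z ⟶
N`. Splitting the identities of `Y` and `Z` off the cone of its morphism to `T₂₃` leaves `P ⟶ N ⟶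
Q`. -/
theorem exists_octahedron {f : X ⟶ Y} {g : Y ⟶ Z} {T₁₂ : CyclicComplex X Y P}
    {T₂₃ : CyclicComplex Y Z Q} {T₁₃ : CyclicComplex X Z N} (h₁₂ : T₁₂.IsExact)
    (h₂₃ : T₂₃.IsExact) (h₁₃ : T₁₃.IsExact) (hf : T₁₂.f = f) (hg : T₂₃.f = g)
    (hfg : T₁₃.f = f ≫ g) :
    ∃ (m₁ : P ⟶ N) (m₃ : N ⟶ Q), T₁₂.i ≫ m₁ = g ≫ T₁₃.i ∧ m₁ ≫ T₁₃.q = T₁₂.q ∧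
      T₁₃.i ≫ m₃ = T₂₃.i ∧ T₁₃.q ≫ f = m₃ ≫ T₂₃.q ∧
      ∃ T : CyclicComplex P N Q, T.IsExact ∧ T.f = m₁ ∧ T.i = m₃ ∧ T.q = T₂₃.q ≫ T₁₂.i := by
  subst hf hg
  obtain ⟨φ, hφa, hφb, hφ⟩ := h₁₂.exists_hom_cone h₁₃ (𝟙 X) T₂₃.f (by rw [hfg, id_comp])
  have hi := φ.i_c
  have hq := φ.q_a
  simp only [hφa, hφb, comp_id] at hi hq
  let S : CyclicComplex Y (P ⊞ Z) N :=
    { f := biprod.lift (-T₁₂.i) T₂₃.f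
      i := biprod.desc φ.c T₁₃.i
      q := T₁₃.q ≫ T₁₂.f
      f_i := by simp [hi]
      i_q := by apply biprod.hom_ext' <;> simp [← reassoc_of% hq]
      q_f := by apply biprod.hom_ext <;> simp [← hfg] }
  have hS : S.IsExact := by
    refine hφ.of_retract
      ⟨biprod.lift (𝟙 Y) 0, 𝟙 _, biprod.lift (-T₁₃.q) (𝟙 N), ?_, ?_, ?_⟩
      ⟨biprod.desc (𝟙 Y) T₁₂.f, 𝟙 _, biprod.desc 0 (𝟙 N), ?_, ?_, ?_⟩ ?_ ?_ ?_
    · simp [S, hφb]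
    · apply biprod.hom_ext' <;> apply biprod.hom_ext <;> simp [S, hq]
    · apply biprod.hom_ext <;> simp [S, hφa]
    · apply biprod.hom_ext' <;> apply biprod.hom_ext <;> simp [S, hφb, hfg]
    · apply biprod.hom_ext' <;> simp [S]
    · apply biprod.hom_ext' <;> simp [S, hφa]
    · simp
    · simp
    · simp
  obtain ⟨ψ, hψa, hψb, hψ⟩ := hS.exists_hom_cone h₂₃ (𝟙 Y) biprod.snd (by simp [S])
  have hi' := ψ.i_c
  have hq' := ψ.q_a
  simp only [S, hψa, hψb, comp_id] at hi' hq'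
  have h₁ : T₁₃.i ≫ ψ.c = T₂₃.i := by simpa using congr(biprod.inr ≫ $hi')
  have h₂ : φ.c ≫ ψ.c = 0 := by simpa using congr(biprod.inl ≫ $hi')
  refine ⟨φ.c, ψ.c, hi, hq.symm, h₁, hq', ⟨φ.c, ψ.c, T₂₃.q ≫ T₁₂.i, h₂, ?_, ?_⟩, ?_, rfl,
    rfl, rfl⟩
  · simp [← reassoc_of% hq']
  · simp [hi]
  · refine hψ.of_retract
      ⟨biprod.lift (biprod.lift (-𝟙 P) 0) 0, biprod.lift (𝟙 N) 0, biprod.lift (-T₂₃.q) (𝟙 Q),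
        ?_, ?_, ?_⟩
      ⟨biprod.desc (biprod.desc (-𝟙 P) 0) T₁₂.i, biprod.desc (𝟙 N) T₁₃.i,
        biprod.desc 0 (𝟙 Q), ?_, ?_, ?_⟩ ?_ ?_ ?_
    · apply biprod.hom_ext <;> simp [S, hψb]
    · apply biprod.hom_ext <;> simp [S, hq']
    · apply biprod.hom_ext
      · apply biprod.hom_ext <;> simp [S, hψa]
      · simp [S, hψa]
    · apply biprod.hom_ext'
      · apply biprod.hom_ext' <;> simp [S, hψb]
      · simp [hi, hψb]
    · apply biprod.hom_ext' <;> simp [S, h₁]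
    · apply biprod.hom_ext' <;> simp [S, hψa]
    · simp
    · simp
    · simp

end CyclicComplex
end FreeTriangulation

/-! ### Linear algebra over the local ring -/

namespace FreeTriangulation

section Algebra

theorem _root_.LinearMap.exists_comp_comp_eq {k V W : Type*} [Field k] [AddCommGroup V]
    [Module k V] [AddCommGroup W] [Module k W] (f : V →ₗ[k] W) :
    ∃ g : W →ₗ[k] V, f ∘ₗ g ∘ₗ f = f := by
  obtain ⟨s, hs⟩ := f.rangeRestrict.exists_rightInverse_of_surjective f.range_rangeRestrict
  obtain ⟨l, hl⟩ := f.range.subtype.exists_leftInverse_of_injective f.range.ker_subtype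
  refine ⟨s ∘ₗ l, LinearMap.ext fun v ↦ ?_⟩
  have h₁ : l (f v) = f.rangeRestrict v := LinearMap.congr_fun hl (f.rangeRestrict v)
  have h₂ := congr(($hs (f.rangeRestrict v) : W))
  simpa [h₁] using h₂

theorem _root_.Matrix.exists_mul_mul_eq {k m n : Type*} [Field k] [Fintype m] [Fintype n]
    [DecidableEq m] [DecidableEq n] (M : Matrix m n k) : ∃ N : Matrix n m k, M * N * M = M := by
  obtain ⟨g, hg⟩ := (Matrix.toLin' M).exists_comp_comp_eq
  refine ⟨LinearMap.toMatrix' g, Matrix.toLin'.injective ?_⟩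
  rw [Matrix.toLin'_mul, Matrix.toLin'_mul, Matrix.toLin'_toMatrix', LinearMap.comp_assoc, hg]

variable {R : Type u} [CommRing R] [IsLocalRing R]

/-- A generalized inverse over the residue field is lifted entrywise; the error has entries in the
maximal ideal `(2)`. -/
theorem exists_mul_mul_add_two_smul (hm : IsLocalRing.maximalIdeal R = Ideal.span {2})
    {m n : Type*} [Fintype m] [Fintype n] [DecidableEq m] [DecidableEq n] (M : Matrix m n R) :
    ∃ (N : Matrix n m R) (Z : Matrix m n R), M * N * M + 2 • Z = M := by
  obtain ⟨N', hN'⟩ := (M.map (IsLocalRing.residue R)).exists_mul_mul_eq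
  choose N hN using fun i j ↦ IsLocalRing.residue_surjective (N' i j)
  have hNN' : N' = (Matrix.of N).map (IsLocalRing.residue R) := by
    ext i j; simp [hN]
  have key (i j) : ∃ z, (M - M * Matrix.of N * M) i j = 2 * z := by
    have : (M - M * Matrix.of N * M) i j ∈ IsLocalRing.maximalIdeal R := by
      rw [← IsLocalRing.residue_eq_zero_iff]
      have := congr_fun₂ hN' i j
      rw [hNN', ← Matrix.map_mul, ← Matrix.map_mul, Matrix.map_apply, Matrix.map_apply] at this
      rw [Matrix.sub_apply, map_sub, this, sub_self]
    rw [hm, Ideal.mem_span_singleton] at this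
    exact this
  choose Z hZ using key
  refine ⟨Matrix.of N, Matrix.of Z, ?_⟩
  ext i j
  have := hZ i j
  simp only [Matrix.sub_apply, Matrix.add_apply, Matrix.smul_apply, Matrix.of_apply,
    nsmul_eq_mul, Nat.cast_ofNat] at this ⊢
  linear_combination -this

/-- A unit killing `2` would make the maximal ideal zero. -/
theorem exists_eq_two_mul (hm : IsLocalRing.maximalIdeal R = Ideal.span {2})
    (hm_ne : IsLocalRing.maximalIdeal R ≠ ⊥) (r : R) (hr : 2 * r = 0) : ∃ s, r = 2 * s := by
  have : r ∈ IsLocalRing.maximalIdeal R := by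
    rw [IsLocalRing.mem_maximalIdeal, mem_nonunits_iff]
    intro h
    apply hm_ne
    rw [hm, (h.mul_left_eq_zero).1 hr]
    simp
  rwa [hm, Ideal.mem_span_singleton] at this

theorem _root_.Module.Free.exists_eq_two_smul {M : Type*} [AddCommGroup M] [Module R M]
    [Module.Free R M] [Module.Finite R M]
    (hm : IsLocalRing.maximalIdeal R = Ideal.span {2})
    (hm_ne : IsLocalRing.maximalIdeal R ≠ ⊥) (x : M) (hx : (2 : R) • x = 0) :
    ∃ y, x = (2 : R) • y := by
  let b := Module.Free.chooseBasis R M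
  have key (i) : ∃ s, b.repr x i = 2 * s :=
    exists_eq_two_mul hm hm_ne _ (by simpa using congr(b.repr $hx i))
  choose s hs using key
  refine ⟨∑ i, s i • b i, ?_⟩
  conv_lhs => rw [← b.sum_repr x]
  simp [hs, mul_smul, Finset.smul_sum]

end Algebra

variable {R : Type u} [CommRing R]

namespace FiniteFree

instance (X : FiniteFree R) : Module.Finite R X.obj := X.property.1

instance (X : FiniteFree R) : Module.Free R X.obj := X.property.2

/-- The underlying linear map of a morphism. -/
def toLin {X Y : FiniteFree R} (f : X ⟶ Y) : X.obj →ₗ[R] Y.obj := f.hom.hom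

/-- The morphism given by a linear map. -/
def ofLin {X Y : FiniteFree R} (f : X.obj →ₗ[R] Y.obj) : X ⟶ Y :=
  ObjectProperty.homMk (ModuleCat.ofHom f)

@[simp] theorem toLin_ofLin {X Y : FiniteFree R} (f : X.obj →ₗ[R] Y.obj) :
    toLin (ofLin f) = f := rfl

theorem toLin_injective {X Y : FiniteFree R} :
    Function.Injective (toLin : (X ⟶ Y) → (X.obj →ₗ[R] Y.obj)) := fun _ _ h ↦
  ObjectProperty.hom_ext _ (ModuleCat.hom_ext h)

@[simp] theorem toLin_comp {X Y Z : FiniteFree R} (f : X ⟶ Y) (g : Y ⟶ Z) :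
    toLin (f ≫ g) = toLin g ∘ₗ toLin f := rfl

@[simp] theorem toLin_zero (X Y : FiniteFree R) : toLin (0 : X ⟶ Y) = 0 := rfl

@[simp] theorem toLin_add {X Y : FiniteFree R} (f g : X ⟶ Y) :
    toLin (f + g) = toLin f + toLin g := rfl

@[simp] theorem toLin_two_smul {X Y : FiniteFree R} (f : X ⟶ Y) :
    toLin (2 • f) = (2 : R) • toLin f := by
  rw [two_nsmul, toLin_add, two_smul]

/-- `toLin` as a homomorphism of additive groups. -/
def toLinHom (X Y : FiniteFree R) : (X ⟶ Y) →+ (X.obj →ₗ[R] Y.obj) where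
  toFun := toLin
  map_zero' := rfl
  map_add' _ _ := rfl

theorem isTwoRegular [IsLocalRing R] (hm : IsLocalRing.maximalIdeal R = Ideal.span {2})
    (hm_ne : IsLocalRing.maximalIdeal R ≠ ⊥) (hm_sq : IsLocalRing.maximalIdeal R ^ 2 = ⊥) :
    IsTwoRegular (FiniteFree R) where
  four_smul x := by
    have h : (2 : R) * 2 = 0 := by
      have : (2 : R) * 2 ∈ IsLocalRing.maximalIdeal R ^ 2 := by
        rw [hm, pow_two]
        exact Ideal.mul_mem_mul (Ideal.mem_span_singleton_self _) (Ideal.mem_span_singleton_self _)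
      simpa [hm_sq] using this
    apply toLin_injective
    rw [toLin_two_smul, toLin_two_smul, smul_smul, h, zero_smul, toLin_zero]
  exists_eq_two_smul {X Y} x hx := by
    let b := Module.Free.chooseBasis R X.obj
    have key (i) : ∃ y, toLin x (b i) = (2 : R) • y :=
      Module.Free.exists_eq_two_smul hm hm_ne _ (by simpa using congr(toLin $hx (b i)))
    choose y hy using key
    refine ⟨ofLin (b.constr R y), toLin_injective (b.ext fun i ↦ ?_)⟩
    simp [hy]
  exists_inverse_mod_two {X Y} x := by
    classical
    let b := Module.Free.chooseBasis R X.obj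
    let c := Module.Free.chooseBasis R Y.obj
    obtain ⟨N, Z, h⟩ := exists_mul_mul_add_two_smul hm (LinearMap.toMatrix b c (toLin x))
    refine ⟨ofLin (Matrix.toLin c b N), ofLin (Matrix.toLin b c Z), toLin_injective ?_⟩
    apply (LinearMap.toMatrix b c).injective
    rw [toLin_add, toLin_two_smul, toLin_comp, toLin_comp, map_add, map_smul,
      LinearMap.toMatrix_comp b c c, LinearMap.toMatrix_comp c b c, toLin_ofLin, toLin_ofLin,
      LinearMap.toMatrix_toLin, LinearMap.toMatrix_toLin]
    conv_rhs => rw [← h]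
    rw [two_smul, two_nsmul]

/-- The image of an idempotent is finitely generated projective, hence free over a local ring. -/
theorem isIdempotentComplete [IsLocalRing R] : IsIdempotentComplete (FiniteFree R) where
  idempotents_split X p hp := by
    have hp' : toLin p ∘ₗ toLin p = toLin p := congr(toLin $hp)
    have hs : (toLin p).rangeRestrict ∘ₗ (toLin p).range.subtype = LinearMap.id := by
      ext ⟨_, v, rfl⟩
      exact LinearMap.congr_fun hp' v
    have : Module.Projective R (toLin p).range :=
      Module.Projective.of_split _ _ hs
    have : Module.Finite R (toLin p).range := inferInstance
    have : Module.Free R (toLin p).range := Module.free_of_flat_of_isLocalRing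
    let Y : FiniteFree R := ⟨ModuleCat.of R (toLin p).range, ‹_›, ‹_›⟩
    exact ⟨Y, ofLin (X := Y) (toLin p).range.subtype, ofLin (Y := Y) (toLin p).rangeRestrict,
      toLin_injective hs, toLin_injective rfl⟩

/-- Reduces `fill` for arbitrary `W` to the case of `R`, the only one a given triangulation supplies
directly. -/
theorem exists_sum_comp_eq_id (X : FiniteFree R) : ∃ (n : ℕ) (π : Fin n → (X ⟶ unit R))
    (ι : Fin n → (unit R ⟶ X)), ∑ j, π j ≫ ι j = 𝟙 X := by
  let b := (Module.Free.chooseBasis R X.obj).reindex (Fintype.equivFin _)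
  refine ⟨_, fun j ↦ ofLin (Y := unit R) (b.coord j),
    fun j ↦ ofLin (X := unit R) (LinearMap.toSpanSingleton R X.obj (b j)),
    toLin_injective (LinearMap.ext fun v ↦ ?_)⟩
  change toLinHom X X _ v = v
  rw [map_sum, LinearMap.sum_apply]
  exact b.sum_repr v

end FiniteFree
end FreeTriangulation

/-! ### The triangulation and its uniqueness -/

namespace FreeTriangulation

variable {R : Type u} [CommRing R]

/-- A triangle is exact if its underlying three-periodic complex is. -/
def IsExactTriangle (T : Triangle (FiniteFree R)) : Prop :=
  ∃ S : CyclicComplex T.obj₁ T.obj₂ T.obj₃,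
    S.IsExact ∧ S.f = T.mor₁ ∧ S.i = T.mor₂ ∧ S.q = (T.mor₃ : T.obj₃ ⟶ T.obj₁)

/-- The triangle associated with a three-periodic complex. -/
def CyclicComplex.toTriangle {A B C : FiniteFree R} (S : CyclicComplex A B C) :
    Triangle (FiniteFree R) :=
  Triangle.mk S.f S.i (S.q : C ⟶ A)

theorem CyclicComplex.IsExact.isExactTriangle {A B C : FiniteFree R} {S : CyclicComplex A B C}
    (hS : S.IsExact) : IsExactTriangle S.toTriangle :=
  ⟨S, hS, rfl, rfl, rfl⟩

theorem IsExactTriangle.exists_mk_eq_toTriangle {A B C : FiniteFree R} {f : A ⟶ B} {i : B ⟶ C}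
    {q : C ⟶ A⟦(1 : ℤ)⟧} (hT : IsExactTriangle (Triangle.mk f i q)) :
    ∃ S : CyclicComplex A B C, S.IsExact ∧ S.f = f ∧ Triangle.mk f i q = S.toTriangle := by
  obtain ⟨(S : CyclicComplex A B C), hS, (h₁ : S.f = f), (h₂ : S.i = i),
    (h₃ : S.q = (q : C ⟶ A))⟩ := hT
  subst h₁ h₂ h₃
  exact ⟨S, hS, rfl, rfl⟩

theorem IsExactTriangle.exists_eq_toTriangle {T : Triangle (FiniteFree R)}
    (hT : IsExactTriangle T) :
    ∃ (A B C : FiniteFree R) (S : CyclicComplex A B C), S.IsExact ∧ T = S.toTriangle := by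
  obtain ⟨A, B, C, f, i, q⟩ := T
  obtain ⟨S, hS, _, h⟩ := IsExactTriangle.exists_mk_eq_toTriangle hT
  exact ⟨A, B, C, S, hS, h⟩

theorem CyclicComplex.IsExact.exists_inverse_rotate [IsTwoRegular (FiniteFree R)]
    {A B C : FiniteFree R} {S : CyclicComplex B C A} (hS : S.IsExact) :
    ∃ T : CyclicComplex A B C, T.IsExact ∧ T.f = -S.q ∧ T.i = S.f ∧ T.q = S.i := by
  obtain ⟨f, i, q, h₁, h₂, h₃⟩ := S
  refine ⟨⟨-q, f, i, by simpa using h₃, h₁, by simpa using h₂⟩,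
    CyclicComplex.isExact_rotate_iff.1 ?_, rfl, rfl, rfl⟩
  simpa only [CyclicComplex.rotate, neg_neg] using hS

theorem CyclicComplex.IsExact.exists_of_iso [IsTwoRegular (FiniteFree R)]
    {A B C A' B' C' : FiniteFree R} {S : CyclicComplex A B C} (hS : S.IsExact)
    {f : A' ⟶ B'} {i : B' ⟶ C'} {q : C' ⟶ A'} (a : A' ⟶ A) (b : B' ⟶ B) (c : C' ⟶ C)
    (a' : A ⟶ A') (b' : B ⟶ B') (c' : C ⟶ C') (ha : a ≫ a' = 𝟙 _) (hb : b ≫ b' = 𝟙 _)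
    (hc : c ≫ c' = 𝟙 _) (h₁ : f ≫ b = a ≫ S.f) (h₂ : i ≫ c = b ≫ S.i) (h₃ : q ≫ a = c ≫ S.q)
    (h₁' : S.f ≫ b' = a' ≫ f) (h₂' : S.i ≫ c' = b' ≫ i) (h₃' : S.q ≫ a' = c' ≫ q) :
    ∃ T : CyclicComplex A' B' C', T.IsExact ∧ T.f = f ∧ T.i = i ∧ T.q = q := by
  have hf : f = a ≫ S.f ≫ b' := by rw [← reassoc_of% h₁, hb, comp_id]
  have hi : i = b ≫ S.i ≫ c' := by rw [← reassoc_of% h₂, hc, comp_id]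
  have hq : q = c ≫ S.q ≫ a' := by rw [← reassoc_of% h₃, ha, comp_id]
  refine ⟨⟨f, i, q, ?_, ?_, ?_⟩, hS.of_retract ⟨a, b, c, h₁, h₂, h₃⟩ ⟨a', b', c', h₁', h₂', h₃'⟩
    ha hb hc, rfl, rfl, rfl⟩
  · rw [hi, reassoc_of% h₁]; simp
  · rw [hq, reassoc_of% h₂]; simp
  · rw [hf, reassoc_of% h₃]; simp

/-- The isomorphism of triangles given by a morphism with invertible components. -/
noncomputable def CyclicComplex.Hom.toTriangleIso {A B C A' B' C' : FiniteFree R}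
    {S : CyclicComplex A B C} {T : CyclicComplex A' B' C'} (φ : Hom S T)
    (ha : IsIso φ.a) (hb : IsIso φ.b) (hc : IsIso φ.c) :
    S.toTriangle ≅ T.toTriangle :=
  Triangle.isoMk _ _ (@asIso _ _ _ _ φ.a ha) (@asIso _ _ _ _ φ.b hb) (@asIso _ _ _ _ φ.c hc)
    φ.f_b φ.i_c φ.q_a

theorem CyclicComplex.IsNullhomotopic.isContractible {A B C : FiniteFree R}
    {S : CyclicComplex A B C} (hS : S.IsNullhomotopic) : IsContractible S.toTriangle := by
  obtain ⟨Θ, Φ, Ψ, hA, hB, hC⟩ := hS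
  exact ⟨⟨S.f_i, S.i_q, S.q_f⟩, Θ, Φ, Ψ, hB.symm, hC.symm, hA.symm⟩

theorem CyclicComplex.directSum_toTriangle {A B C A' B' C' : FiniteFree R}
    (S : CyclicComplex A B C) (T : CyclicComplex A' B' C') :
    directSum S.toTriangle T.toTriangle = (S.sum T).toTriangle := by
  have h : biprod.desc (S.q ≫ biprod.inl) (T.q ≫ biprod.inr) = biprod.map S.q T.q := by
    apply biprod.hom_ext' <;> simp
  exact congr(Triangle.mk (C := FiniteFree R) (biprod.map S.f T.f) (biprod.map S.i T.i) $h)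

/-- Exactness of the distinguished triangles of any triangulation for which `twoTriangle unit` is
distinguished. -/
theorem isExactTriangle_of_mem (P : Pretriangulated (FiniteFree R))
    (hP : twoTriangle (FiniteFree.unit R) ∈ P.distinguishedTriangles)
    {T : Triangle (FiniteFree R)} (hT : T ∈ P.distinguishedTriangles) : IsExactTriangle T := by
  have h₁₂ := @Pretriangulated.comp_distTriang_mor_zero₁₂ _ _ _ _ _ _ P T hT
  have h₂₃ := @Pretriangulated.comp_distTriang_mor_zero₂₃ _ _ _ _ _ _ P T hT
  have h₃₁ := @Pretriangulated.comp_distTriang_mor_zero₃₁ _ _ _ _ _ _ P T hT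
  refine ⟨⟨T.mor₁, T.mor₂, T.mor₃, h₁₂, h₂₃, h₃₁⟩, ⟨?_, ?_, ?_, ?_⟩, rfl, rfl, rfl⟩
  · intro W x hx
    have hT' := @Pretriangulated.rot_of_distTriang _ _ _ _ _ _ P T hT
    have aux (y : T.obj₂ ⟶ W) (hy : x = (-T.mor₁) ≫ y) : ∃ y, x = T.mor₁ ≫ y :=
      ⟨-y, by simpa using hy⟩
    obtain ⟨y, hy⟩ := @Triangle.yoneda_exact₃ _ _ _ _ _ _ P _ hT' W x hx
    exact aux y hy
  · exact fun {W} x hx ↦ @Triangle.yoneda_exact₂ _ _ _ _ _ _ P T hT W x hx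
  · exact fun {W} x hx ↦ @Triangle.yoneda_exact₃ _ _ _ _ _ _ P T hT W x hx
  · intro W a b hab
    obtain ⟨n, π, ι, hπι⟩ := FiniteFree.exists_sum_comp_eq_id W
    replace hab : T.mor₁ ≫ b = 2 • a := hab
    have key (j : Fin n) : ∃ c : T.obj₃ ⟶ FiniteFree.unit R, T.mor₂ ≫ c = 2 • b ≫ π j ∧
        (T.mor₃ : T.obj₃ ⟶ T.obj₁) ≫ a ≫ π j = 2 • c := by
      have comm : T.mor₁ ≫ b ≫ π j = (a ≫ π j) ≫ (2 • 𝟙 (FiniteFree.unit R)) := by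
        rw [reassoc_of% hab]; simp
      obtain ⟨(c : T.obj₃ ⟶ FiniteFree.unit R),
        (hc : T.mor₂ ≫ c = (b ≫ π j) ≫ (2 • 𝟙 (FiniteFree.unit R))),
        (hc' : (T.mor₃ : T.obj₃ ⟶ T.obj₁) ≫ a ≫ π j = c ≫ (2 • 𝟙 (FiniteFree.unit R)))⟩ :=
        P.complete_distinguished_triangle_morphism T _ hT hP (a ≫ π j) (b ≫ π j) comm
      exact ⟨c, hc.trans (by simp), hc'.trans (by simp)⟩
    choose c hc hc' using key
    refine ⟨∑ j, c j ≫ ι j, ?_, ?_⟩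
    · calc T.mor₂ ≫ ∑ j, c j ≫ ι j = 2 • b ≫ ∑ j, π j ≫ ι j := by
            simp only [Preadditive.comp_sum, ← assoc, hc, Finset.smul_sum, Preadditive.nsmul_comp]
        _ = 2 • b := by rw [hπι, comp_id]
    · calc (T.mor₃ : T.obj₃ ⟶ T.obj₁) ≫ a = (T.mor₃ : T.obj₃ ⟶ T.obj₁) ≫ a ≫ ∑ j, π j ≫ ι j := by
            rw [hπι, comp_id]
        _ = 2 • ∑ j, c j ≫ ι j := by
            simp only [Preadditive.comp_sum, Finset.smul_sum, ← Preadditive.nsmul_comp, ← hc',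
              assoc]

variable [IsTwoRegular (FiniteFree R)]

theorem IsExactTriangle.of_iso {T T' : Triangle (FiniteFree R)} (hT : IsExactTriangle T)
    (e : T' ≅ T) : IsExactTriangle T' := by
  obtain ⟨A, B, C, S, hS, rfl⟩ := hT.exists_eq_toTriangle
  obtain ⟨S', hS', h₁, h₂, h₃⟩ := hS.exists_of_iso (f := T'.mor₁) (i := T'.mor₂) (q := T'.mor₃)
    e.hom.hom₁ e.hom.hom₂ e.hom.hom₃ e.inv.hom₁ e.inv.hom₂ e.inv.hom₃
    e.hom_inv_id_triangle_hom₁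
    e.hom_inv_id_triangle_hom₂ e.hom_inv_id_triangle_hom₃ e.hom.comm₁ e.hom.comm₂
    e.hom.comm₃ e.inv.comm₁ e.inv.comm₂ e.inv.comm₃
  exact ⟨S', hS', h₁, h₂, h₃⟩

theorem isExactTriangle_twoTriangle (X : FiniteFree R) : IsExactTriangle (twoTriangle X) :=
  ⟨CyclicComplex.two X, CyclicComplex.isExact_two X, rfl, rfl, rfl⟩

theorem IsContractible.isExactTriangle {K : Triangle (FiniteFree R)} (hK : IsContractible K) :
    IsExactTriangle K := by
  obtain ⟨⟨h₁, h₂, h₃⟩, Θ, Φ, Ψ, hB, hC, hA⟩ := hK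
  refine ⟨⟨K.mor₁, K.mor₂, K.mor₃, h₁, h₂, h₃⟩, ?_, rfl, rfl, rfl⟩
  exact CyclicComplex.IsNullhomotopic.isExact ⟨Θ, Φ, Ψ, hA.symm, hB.symm, hC.symm⟩

variable [IsIdempotentComplete (FiniteFree R)]

variable (R) in
/-- The triangulation of the category of finitely generated free modules. -/
abbrev pretriangulated : Pretriangulated (FiniteFree R) where
  distinguishedTriangles := {T | IsExactTriangle T}
  isomorphic_distinguished T hT T' e := hT.of_iso e
  contractible_distinguished X := by
    refine ⟨⟨𝟙 X, 0, 0, comp_zero, comp_zero, zero_comp⟩, ?_, rfl, rfl, rfl⟩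
    refine CyclicComplex.IsNullhomotopic.isExact ⟨𝟙 X, 0, 0, ?_, ?_, ?_⟩
    · exact (add_eq_left.2 comp_zero).trans (comp_id _)
    · exact (add_eq_right.2 comp_zero).trans (comp_id _)
    · exact (isZero_zero _).eq_of_src _ _
  distinguished_cocone_triangle {X Y} f := by
    obtain ⟨C, T, rfl, hT⟩ := CyclicComplex.exists_isExact f
    exact ⟨C, T.i, T.q, hT.isExactTriangle⟩
  rotate_distinguished_triangle T := by
    constructor
    · rintro ⟨S, hS, h₁, h₂, h₃⟩
      exact ⟨S.rotate, CyclicComplex.isExact_rotate_iff.2 hS, h₂, h₃, congr(-$h₁)⟩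
    · rintro ⟨S, hS, h₁, h₂, h₃⟩
      obtain ⟨S', hS', h₁', h₂', h₃'⟩ := hS.exists_inverse_rotate
      exact ⟨S', hS', h₁'.trans (neg_eq_iff_eq_neg.2 h₃), h₂'.trans h₁, h₃'.trans h₂⟩
  complete_distinguished_triangle_morphism T T' hT hT' a b hab := by
    obtain ⟨S, hS, h₁, h₂, h₃⟩ := hT
    obtain ⟨S', hS', h₁', h₂', h₃'⟩ := hT'
    rw [← h₁, ← h₁'] at hab
    obtain ⟨φ, rfl, rfl⟩ := hS.exists_hom hS' a b hab
    refine ⟨φ.c, ?_, ?_⟩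
    · rw [← h₂, ← h₂', φ.i_c]
    · change (T.mor₃ : T.obj₃ ⟶ T.obj₁) ≫ φ.a = φ.c ≫ (T'.mor₃ : T'.obj₃ ⟶ T'.obj₁)
      rw [← h₃, ← h₃', φ.q_a]

attribute [local instance] pretriangulated

theorem isTriangulated : IsTriangulated (FiniteFree R) where
  octahedron_axiom := by
    intro X Y Z P Q N f g _ rfl i₁₂ q₁₂ h₁₂ i₂₃ q₂₃ h₂₃ i₁₃ q₁₃ h₁₃
    obtain ⟨(T₁₂ : CyclicComplex X Y P), hT₁₂, (hf₁₂ : T₁₂.f = f), (hi₁₂ : T₁₂.i = i₁₂),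
      (hq₁₂ : T₁₂.q = (q₁₂ : P ⟶ X))⟩ := id h₁₂
    obtain ⟨(T₂₃ : CyclicComplex Y Z Q), hT₂₃, (hf₂₃ : T₂₃.f = g), (hi₂₃ : T₂₃.i = i₂₃),
      (hq₂₃ : T₂₃.q = (q₂₃ : Q ⟶ Y))⟩ := id h₂₃
    obtain ⟨(T₁₃ : CyclicComplex X Z N), hT₁₃, (hf₁₃ : T₁₃.f = f ≫ g), (hi₁₃ : T₁₃.i = i₁₃),
      (hq₁₃ : T₁₃.q = (q₁₃ : N ⟶ X))⟩ := id h₁₃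
    obtain ⟨m₁, m₃, c₁, c₂, c₃, c₄, T, hT, hf, hi, hq⟩ :=
      CyclicComplex.exists_octahedron hT₁₂ hT₂₃ hT₁₃ hf₁₂ hf₂₃ hf₁₃
    rw [hi₁₂, hi₁₃] at c₁
    rw [hq₁₂, hq₁₃] at c₂
    rw [hi₁₃, hi₂₃] at c₃
    rw [hq₁₃, hq₂₃] at c₄
    rw [hq₂₃, hi₁₂] at hq
    exact ⟨⟨m₁, m₃, c₁, c₂, c₃, c₄, ⟨T, hT, hf, hi, hq⟩⟩⟩

theorem CyclicComplex.IsExact.nonempty_iso {A B C C' : FiniteFree R} {S : CyclicComplex A B C}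
    {T : CyclicComplex A B C'} (hS : S.IsExact) (hT : T.IsExact) (h : S.f = T.f) :
    Nonempty (S.toTriangle ≅ T.toTriangle) := by
  obtain ⟨φ, ha, hb⟩ := hS.exists_hom hT (𝟙 A) (𝟙 B) (by rw [h, id_comp, comp_id])
  have ha' : IsIso φ.a := ha ▸ inferInstance
  have hb' : IsIso φ.b := hb ▸ inferInstance
  exact ⟨φ.toTriangleIso ha' hb' (φ.isIso_c hS hT)⟩

theorem isExactTriangle_iff {T : Triangle (FiniteFree R)} :
    IsExactTriangle T ↔ ∃ (K : Triangle (FiniteFree R)) (X : FiniteFree R),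
      IsContractible K ∧ Nonempty (T ≅ directSum K (twoTriangle X)) := by
  constructor
  · intro hT
    obtain ⟨A, B, C, S, hS, rfl⟩ := hT.exists_eq_toTriangle
    obtain ⟨K, L, M, X, U, φ, hU, ha, hb, hc⟩ := hS.exists_hom_sum
    refine ⟨U.toTriangle, X, hU.isContractible, ⟨?_⟩⟩
    exact φ.toTriangleIso ha hb hc ≪≫
      eqToIso (U.directSum_toTriangle (CyclicComplex.two X)).symm
  · rintro ⟨K, X, hK, ⟨e⟩⟩
    refine IsExactTriangle.of_iso ?_ e
    obtain ⟨A, B, C, S, hS, rfl⟩ := hK.isExactTriangle.exists_eq_toTriangle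
    exact (S.directSum_toTriangle (CyclicComplex.two X)) ▸
      (hS.sum (CyclicComplex.isExact_two X)).isExactTriangle

/-- For the converse, `P` has some triangle on the first map of an exact complex; it is exact too,
hence isomorphic to the given one. -/
theorem mem_distinguishedTriangles_iff (P : Pretriangulated (FiniteFree R))
    (hP : twoTriangle (FiniteFree.unit R) ∈ P.distinguishedTriangles)
    {T : Triangle (FiniteFree R)} : T ∈ P.distinguishedTriangles ↔ IsExactTriangle T := by
  refine ⟨isExactTriangle_of_mem P hP, fun hT ↦ ?_⟩
  obtain ⟨A, B, C, S, hS, rfl⟩ := hT.exists_eq_toTriangle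
  obtain ⟨C', i, q, h⟩ := P.distinguished_cocone_triangle S.f
  obtain ⟨S', hS', hf, hS''⟩ := (isExactTriangle_of_mem P hP h).exists_mk_eq_toTriangle
  obtain ⟨e⟩ := hS.nonempty_iso hS' hf.symm
  exact P.isomorphic_distinguished _ (hS'' ▸ h) _ e

end FreeTriangulation

open FreeTriangulation in
theorem theorem1 {R : Type u} [CommRing R] [IsLocalRing R]
    (hm : IsLocalRing.maximalIdeal R = Ideal.span {2})
    (hm_ne : IsLocalRing.maximalIdeal R ≠ ⊥)
    (hm_sq : IsLocalRing.maximalIdeal R ^ 2 = ⊥) :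
    (∃! P : Pretriangulated (FreeTriangulation.FiniteFree R),
      IsTriangulated (FreeTriangulation.FiniteFree R) ∧
        FreeTriangulation.twoTriangle (FreeTriangulation.FiniteFree.unit R) ∈
          P.distinguishedTriangles) ∧
    ∀ P : Pretriangulated (FreeTriangulation.FiniteFree R),
      IsTriangulated (FreeTriangulation.FiniteFree R) →
      FreeTriangulation.twoTriangle (FreeTriangulation.FiniteFree.unit R) ∈
        P.distinguishedTriangles →
      ∀ T : Triangle (FreeTriangulation.FiniteFree R),
        T ∈ P.distinguishedTriangles ↔
          ∃ (K : Triangle (FreeTriangulation.FiniteFree R))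
            (X : FreeTriangulation.FiniteFree R),
            FreeTriangulation.IsContractible K ∧
              Nonempty (T ≅ FreeTriangulation.directSum K (FreeTriangulation.twoTriangle X)) := by
  have := FiniteFree.isTwoRegular hm hm_ne hm_sq
  have := FiniteFree.isIdempotentComplete (R := R)
  refine ⟨⟨pretriangulated R, ⟨isTriangulated, isExactTriangle_twoTriangle _⟩, ?_⟩, ?_⟩
  · rintro P ⟨_, hP⟩
    have h : P.distinguishedTriangles = {T | IsExactTriangle T} :=
      Set.ext fun T ↦ mem_distinguishedTriangles_iff P hP
    -- The class of distinguished triangles is the only data in the structure; the other fields are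
    -- proofs.
    obtain ⟨D, _, _, _, _, _⟩ := P
    dsimp only at h
    subst h
    rfl
  · intro P _ hP T
    rw [mem_distinguishedTriangles_iff P hP, isExactTriangle_iff]
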